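/- All graphs are finite simplicial graphs whose edges $e$ are labelled by integers $m_e\ge 2$. The Artin group of such a labelled graph $\Gamma$ is $$A_\Gamma=\big\langle V(\Gamma)\ \big|\ \langle x,y\rangle^{m_e}=\langle y,x\rangle^{m_e}\ \text{ for each edge } e=\{x,y\} \text{ of } \Gamma\big\rangle,$$ where $\langle x,y\rangle^{m}=xyx\cdots$ is the alternating product with $m$ factors starting with $x$. A labelled subgraph $\Gamma_1\subseteq\Gamma_2$ (not necessarily full) consists of some of the vertices of $\Gamma_2$ and some of the edges of $\Gamma_2$ between them, with the labels of $\Gamma_2$; the inclusion on vertices induces a homomorphism $A_{\Gamma_1}\to A_{\Gamma_2}$. A group $G$ is poly-free if it has a finite chain of subgroups $1=G_0\unlhd G_1\unlhd\cdots\unlhd G_n=G$, each normal in the next, such that every quotient $G_{i}/G_{i-1}$ is a free group of possibly infinite rank; it is normally poly-free if such a chain exists with every $G_i$ normal in $G$. It is virtually poly-free (resp. virtually normally poly-free) if it has a finite-index subgroup that is poly-free (resp. normally poly-free). (1) Let $\Gamma_1\subseteq\Gamma_2$ be labelled graphs with $V(\Gamma_1)=V(\Gamma_2)$ such that $\Gamma_2$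 is obtained from $\Gamma_1$ by adding one labelled edge, and let $f\colon A_{\Gamma_1}\to A_{\Gamma_2}$ be the induced homomorphism. Then $\ker(f)$ is a free group (of possibly infinite rank). (2) Let $\Gamma_1\subseteq\Gamma_2$ be any labelled subgraph. If $A_{\Gamma_2}$ is poly-free (resp. normally poly-free, virtually poly-free, virtually normally poly-free), then so is $A_{\Gamma_1}$. -/

import Mathlib

universe u v

/-- A simplicial graph on the vertex set `V` whose edges are labelled by integers `≥ 2`. -/
structure LabelledGraph (V : Type u) where
  graph : SimpleGraph V
  label : graph.EdgeLabeling ℕ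
  two_le_label : ∀ e, 2 ≤ label e

/-- The alternating product `a * b * a * ⋯` with `n` factors, starting with `a`. -/
def alternatingProd {G : Type u} [Group G] (a b : G) : ℕ → G
  | 0 => 1
  | n + 1 => a * alternatingProd b a n

theorem map_alternatingProd {G : Type u} {H : Type v} [Group G] [Group H] (f : G →* H) (n : ℕ) :
    ∀ a b : G, f (alternatingProd a b n) = alternatingProd (f a) (f b) n := by
  induction n with
  | zero => intro a b; simp [alternatingProd]
  | succ n ih => intro a b; simp [alternatingProd, ih]

namespace LabelledGraph

/-- The relators `⟨x, y⟩^m * (⟨y, x⟩^m)⁻¹` of the Artin group, for `x`, `y` the two vertices of an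
edge with label `m`. -/
def artinRelators {V : Type u} (Γ : LabelledGraph V) : Set (FreeGroup V) :=
  {r | ∃ (x y : V) (h : Γ.graph.Adj x y),
    r = alternatingProd (FreeGroup.of x) (FreeGroup.of y) (Γ.label.get x y h) *
      (alternatingProd (FreeGroup.of y) (FreeGroup.of x) (Γ.label.get x y h))⁻¹}

/-- The Artin group of a labelled graph, defined by its standard presentation. -/
abbrev ArtinGroup {V : Type u} (Γ : LabelledGraph V) : Type u :=
  PresentedGroup Γ.artinRelators

/-- An inclusion of labelled graphs: an injective graph homomorphism preserving the labels. It
exhibits `Γ₁` as a (not necessarily full) labelled subgraph of `Γ₂`. -/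
structure Inclusion {V : Type u} {W : Type v} (Γ₁ : LabelledGraph V) (Γ₂ : LabelledGraph W) where
  toFun : V → W
  injective : Function.Injective toFun
  map_adj : ∀ {x y : V}, Γ₁.graph.Adj x y → Γ₂.graph.Adj (toFun x) (toFun y)
  map_label : ∀ {x y : V} (h : Γ₁.graph.Adj x y),
    Γ₂.label.get (toFun x) (toFun y) (map_adj h) = Γ₁.label.get x y h

/-- The homomorphism of Artin groups induced by an inclusion of labelled graphs; it sends the
generator of a vertex to the generator of its image. -/
def Inclusion.artinMap {V : Type u} {W : Type v} {Γ₁ : LabelledGraph V} {Γ₂ : LabelledGraph W}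
    (i : Inclusion Γ₁ Γ₂) : Γ₁.ArtinGroup →* Γ₂.ArtinGroup :=
  PresentedGroup.toGroup (f := fun x => PresentedGroup.of (i.toFun x)) (by
    rintro r ⟨x, y, h, rfl⟩
    have key : (PresentedGroup.mk Γ₂.artinRelators)
        (alternatingProd (FreeGroup.of (i.toFun x)) (FreeGroup.of (i.toFun y))
            (Γ₁.label.get x y h) *
          (alternatingProd (FreeGroup.of (i.toFun y)) (FreeGroup.of (i.toFun x))
            (Γ₁.label.get x y h))⁻¹) = 1 :=
      PresentedGroup.one_of_mem
        ⟨i.toFun x, i.toFun y, i.map_adj h, by rw [i.map_label h]⟩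
    rw [map_mul, map_inv, map_alternatingProd, map_alternatingProd] at key ⊢
    simp only [FreeGroup.lift_apply_of]
    exact key)

theorem Inclusion.artinMap_of {V : Type u} {W : Type v} {Γ₁ : LabelledGraph V}
    {Γ₂ : LabelledGraph W} (i : Inclusion Γ₁ Γ₂) (x : V) :
    i.artinMap (PresentedGroup.of x) = PresentedGroup.of (i.toFun x) :=
  PresentedGroup.toGroup.of _

/-- `Γ₂` is obtained from `Γ₁` by adding one new labelled edge, joining the distinct vertices `a`
and `b`, which are not adjacent in `Γ₁`; the vertex set and all other edges and labels are
unchanged. -/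
structure AddsEdge {V : Type u} (Γ₁ Γ₂ : LabelledGraph V) (a b : V) : Prop where
  ne : a ≠ b
  not_adj : ¬ Γ₁.graph.Adj a b
  adj_iff : ∀ x y : V, Γ₂.graph.Adj x y ↔ Γ₁.graph.Adj x y ∨ s(x, y) = s(a, b)
  label_eq : ∀ (x y : V) (h : Γ₁.graph.Adj x y),
    Γ₂.label.get x y ((adj_iff x y).2 (Or.inl h)) = Γ₁.label.get x y h

/-- The inclusion of `Γ₁` in the graph `Γ₂` obtained by adding an edge: the identity on vertices. -/
def AddsEdge.inclusion {V : Type u} {Γ₁ Γ₂ : LabelledGraph V} {a b : V}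
    (h : AddsEdge Γ₁ Γ₂ a b) : Inclusion Γ₁ Γ₂ where
  toFun := id
  injective := Function.injective_id
  map_adj hxy := (h.adj_iff _ _).2 (Or.inl hxy)
  map_label hxy := h.label_eq _ _ hxy

end LabelledGraph

/-- `G` is poly-free: there is a chain `1 = C 0 ⊴ C 1 ⊴ ⋯ ⊴ C n = G` of subgroups, each normal in
the next one, with free quotients `C (i + 1) / C i` (of possibly infinite rank). -/
def IsPolyFree (G : Type u) [Group G] : Prop :=
  ∃ (n : ℕ) (C : ℕ → Subgroup G), C 0 = ⊥ ∧ C n = ⊤ ∧ ∀ i < n, C i ≤ C (i + 1) ∧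
    ∃ _ : ((C i).subgroupOf (C (i + 1))).Normal,
      IsFreeGroup (C (i + 1) ⧸ (C i).subgroupOf (C (i + 1)))

/-- `G` is normally poly-free: there is a chain as in the definition of poly-free groups whose
members are all normal in `G`. -/
def IsNormallyPolyFree (G : Type u) [Group G] : Prop :=
  ∃ (n : ℕ) (C : ℕ → Subgroup G), C 0 = ⊥ ∧ C n = ⊤ ∧ (∀ i ≤ n, (C i).Normal) ∧
    ∀ i < n, C i ≤ C (i + 1) ∧
      ∃ _ : ((C i).subgroupOf (C (i + 1))).Normal,
        IsFreeGroup (C (i + 1) ⧸ (C i).subgroupOf (C (i + 1)))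

/-- `G` has a poly-free subgroup of finite index. -/
def IsVirtuallyPolyFree (G : Type u) [Group G] : Prop :=
  ∃ H : Subgroup G, H.FiniteIndex ∧ IsPolyFree H

/-- `G` has a normally poly-free subgroup of finite index. -/
def IsVirtuallyNormallyPolyFree (G : Type u) [Group G] : Prop :=
  ∃ H : Subgroup G, H.FiniteIndex ∧ IsNormallyPolyFree H

/-! The kernel statement combines Bass–Serre theory with van der Lek's theorem that Artin groups of
full subgraphs embed. Since `a` and `b` are not adjacent in `Γ₁`, every vertex and every edge of
`Γ₁` avoids `a` or avoids `b`. Hence the Artin group of `Γ₁` is the amalgam of the subgroups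
generated by V∖{a} and by V∖{b}, over the one generated by V∖{a, b}. Deleting an endpoint also
deletes the new edge, so the factors come from full subgraphs of `Γ₂` and embed in its Artin group.
The kernel thus meets the factors trivially and, being normal, would act freely on the Bass–Serre
tree. In place of the tree, the action groupoid on the cosets of the kernel is shown to be free on
explicit generators (`Subgroup.existsUnique_cocycle`); the kernel is one of its vertex groups
(`Subgroup.isFreeGroup_of_amalgam`).

Van der Lek's theorem (`LabelledGraph.Inclusion.artinMap_injective`) is proved by combinatorics in
the Coxeter group W of the big graph, with T the vertices of the full subgraph. A word walks on the
cosets W_T e, with e the minimal representative. The letter i either moves to another coset or, if e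
sᵢ e⁻¹ lies in W_T, is a loop; then e sᵢ e⁻¹ = sⱼ with j ∈ T, and j is recorded. This gives an
action of the big Artin group on (small group) × (cosets), in which the small group acts at the base
coset by right multiplication; injectivity follows. The braid relations have to be respected: the
recorded words of the two sides have repetition-free, mutually reverse inversion sequences and use
at most two letters, so they are equal or the two sides of a braid relation
(`CoxeterSystem.prod_map_eq_of_leftInvSeq_eq_reverse`).

For part (2), a chain pulls back along a homomorphism with free kernel, the kernel giving one more
step, by Nielsen–Schreier. An inclusion of finite labelled graphs is a sequence of single edge
additions followed by a full inclusion. -/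

namespace CoxeterMatrix

/-! ### The geometric representation of a Coxeter matrix -/

open Polynomial.Chebyshev

variable {B : Type*} (M : CoxeterMatrix B)

/-- The linear form `v ↦ 2 ⟨αᵢ, v⟩` on the geometric representation of a Coxeter matrix. -/
noncomputable def coroot (i : B) : Module.Dual ℝ (B →₀ ℝ) :=
  Finsupp.linearCombination ℝ fun j => -2 * Real.cos (Real.pi / M i j)

theorem coroot_single (i j : B) :
    M.coroot i (Finsupp.single j 1) = -2 * Real.cos (Real.pi / M i j) := by
  simp [coroot]

theorem coroot_single_self (i : B) : M.coroot i (Finsupp.single i 1) = 2 := by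
  simp [coroot_single]

/-- The simple reflections of the geometric representation. -/
noncomputable def geometricReflection (i : B) : (B →₀ ℝ) ≃ₗ[ℝ] (B →₀ ℝ) :=
  Module.reflection (M.coroot_single_self i)

/-- This is the trace of sᵢsⱼ on the plane of αᵢ and αⱼ, the argument of the Chebyshev polynomials
that express powers of sᵢsⱼ. -/
theorem coroot_mul_coroot_sub_two (i j : B) :
    M.coroot i (Finsupp.single j 1) * M.coroot j (Finsupp.single i 1) - 2 =
      2 * Real.cos (2 * Real.pi / M i j) := by
  rw [coroot_single, coroot_single, M.symmetric j i, mul_div_assoc 2 Real.pi, Real.cos_two_mul]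
  ring

theorem sin_two_pi_div_ne_zero {m : ℕ} (hm : 3 ≤ m) : Real.sin (2 * Real.pi / m) ≠ 0 := by
  have h3 : (3 : ℝ) ≤ m := by exact_mod_cast hm
  have hpi := Real.pi_pos
  refine (Real.sin_pos_of_pos_of_lt_pi (by positivity) ?_).ne'
  rw [div_lt_iff₀ (by linarith)]
  nlinarith

theorem eval_S_two_mul_cos {θ : ℝ} (hθ : Real.sin θ ≠ 0) (n : ℤ) :
    (S ℝ n).eval (2 * Real.cos θ) = Real.sin ((n + 1) * θ) / Real.sin θ := by
  rw [eq_div_iff hθ, S_two_mul_real_cos]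

theorem geometricReflection_isLiftable : M.IsLiftable M.geometricReflection := by
  intro i j
  rcases eq_or_ne i j with rfl | hij
  · rw [M.diagonal, pow_one]
    ext1 v
    exact Module.involutive_reflection (M.coroot_single_self i) v
  obtain h0 | h2 | h3 : M i j = 0 ∨ M i j = 2 ∨ 3 ≤ M i j := by
    have := M.off_diagonal i j hij
    omega
  · rw [h0, pow_zero]
  -- Here θ = π and sin θ = 0, so the quotient formula for `S` is not available; the two reflections
  -- commute.
  · have hcos : Real.cos (Real.pi / 2) = 0 := Real.cos_pi_div_two
    have h1 : M.coroot i (Finsupp.single j 1) = 0 := by simp [coroot_single, h2]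
    have h1' : M.coroot j (Finsupp.single i 1) = 0 := by simp [coroot_single, M.symmetric j i, h2]
    rw [h2]
    ext1 v
    rw [pow_two]
    simp only [geometricReflection, LinearEquiv.mul_apply, Module.reflection_apply, map_sub,
      map_smul, h1, h1', coroot_single_self, LinearEquiv.coe_one, id]
    module
  · set m := M i j with hm
    set θ := 2 * Real.pi / m with hθdef
    have hθ : Real.sin θ ≠ 0 := sin_two_pi_div_ne_zero h3
    have hmθ : (m : ℝ) * θ = 2 * Real.pi := by
      have : (m : ℝ) ≠ 0 := by positivity
      rw [hθdef]; field_simp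
    ext1 v
    have key := Module.reflection_mul_reflection_pow_apply (M.coroot_single_self i)
      (M.coroot_single_self j) m v (2 * Real.cos θ) (M.coroot_mul_coroot_sub_two i j).symm
    simp only [eval_S_two_mul_cos hθ] at key
    refine key.trans ?_
    -- For m = 2k the relevant value is sin(kθ) = sin π = 0. For m = 2k + 1, sin((k+1)θ) = −sin(kθ),
    -- and the terms cancel in pairs.
    obtain ⟨k, hk | hk⟩ := m.even_or_odd'
    · have e1 : ((m : ℤ) - 1) / 2 = k - 1 := by omega
      have e2 : ((m : ℤ) - 2) / 2 = k - 1 := by omega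
      have hs : Real.sin ((((k : ℤ) - 1 : ℤ) + 1) * θ) = 0 := by
        have : (((k : ℤ) - 1 : ℤ) + 1 : ℝ) * θ = Real.pi := by
          have : (m : ℝ) = 2 * k := by exact_mod_cast hk
          push_cast
          rw [this] at hmθ
          linarith
        rw [this, Real.sin_pi]
      rw [e1, e2, hs]
      simp
    · have e1 : ((m : ℤ) - 1) / 2 = k := by omega
      have e2 : ((m : ℤ) - 2) / 2 = k - 1 := by omega
      have e3 : ((m : ℤ) - 3) / 2 = k - 1 := by omega
      have e4 : (m : ℤ) / 2 = k := by omega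
      have hs : Real.sin ((((k : ℤ) : ℤ) + 1) * θ) = - Real.sin ((((k : ℤ) - 1 : ℤ) + 1) * θ) := by
        have : (((k : ℤ) : ℤ) + 1 : ℝ) * θ = 2 * Real.pi - (((k : ℤ) - 1 : ℤ) + 1) * θ := by
          have : (m : ℝ) = 2 * k + 1 := by exact_mod_cast hk
          push_cast
          rw [this] at hmθ
          linarith
        rw [this, Real.sin_two_pi_sub]
      rw [e1, e2, e3, e4, hs]
      simp [neg_div]

end CoxeterMatrix

/-! ### Orders of products of two simple reflections -/

namespace CoxeterSystem

open Polynomial.Chebyshev CoxeterMatrix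

variable {B W : Type*} [Group W] {M : CoxeterMatrix B} (cs : CoxeterSystem M W)

/-- The geometric representation of a Coxeter group. -/
noncomputable def geometricRep : W →* ((B →₀ ℝ) ≃ₗ[ℝ] (B →₀ ℝ)) :=
  cs.lift ⟨M.geometricReflection, M.geometricReflection_isLiftable⟩

theorem geometricRep_simple (i : B) (v : B →₀ ℝ) :
    cs.geometricRep (cs.simple i) v = v - M.coroot i v • Finsupp.single i 1 := by
  rw [geometricRep, lift_apply_simple]
  exact Module.reflection_apply _ _

theorem geometricRep_simple_self (i : B) :
    cs.geometricRep (cs.simple i) (Finsupp.single i 1) = -Finsupp.single i 1 := by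
  rw [geometricRep_simple, coroot_single_self]
  module

theorem simple_injective : Function.Injective cs.simple := by
  intro i j hij
  by_contra hne
  have h := cs.geometricRep_simple_self i
  rw [hij, geometricRep_simple] at h
  have := DFunLike.congr_fun h i
  simp [Ne.symm hne] at this
  norm_num at this

/-- Compare the coefficients of αᵢ and αⱼ in (sᵢsⱼ)ⁿαᵢ = αᵢ. For m ≥ 3 they give sin(nθ) = 0 and
cos(nθ) = 1 with θ = 2π/m. For m = 0 the αⱼ-coefficient is a nonzero multiple of n; for m = 2 the
αᵢ-coefficient detects the parity of n. -/
theorem dvd_of_simple_mul_simple_pow_eq_one {i j : B} {n : ℕ}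
    (h : (cs.simple i * cs.simple j) ^ n = 1) : M i j ∣ n := by
  rcases eq_or_ne i j with rfl | hij
  · simp
  have key := Module.reflection_mul_reflection_pow_apply_self (M.coroot_single_self i)
      (M.coroot_single_self j) n (2 * Real.cos (2 * Real.pi / M i j))
      (M.coroot_mul_coroot_sub_two i j).symm
  have hrep : ((Module.reflection (M.coroot_single_self i) *
      Module.reflection (M.coroot_single_self j)) ^ n : (B →₀ ℝ) ≃ₗ[ℝ] (B →₀ ℝ)) = 1 := by
    have := congrArg cs.geometricRep h
    rw [map_pow, map_mul, map_one, geometricRep, lift_apply_simple, lift_apply_simple] at this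
    exact this
  rw [hrep] at key
  have ci := DFunLike.congr_fun key i
  have cj := DFunLike.congr_fun key j
  simp [hij, hij.symm, coroot_single, M.symmetric j i] at ci cj
  obtain h0 | h2 | h3 : M i j = 0 ∨ M i j = 2 ∨ 3 ≤ M i j := by
    have := M.off_diagonal i j hij
    omega
  · simp [h0, S_eval_two] at cj
    simp [h0, cj]
  · have h1 : 2 * Real.cos (2 * Real.pi / 2) = -2 := by simp
    rw [h2, Nat.cast_two, h1, S_eval_neg_two, S_eval_neg_two] at ci
    rw [h2]
    by_contra hn
    obtain ⟨k, rfl⟩ : Odd n := by rwa [← even_iff_two_dvd, Nat.not_even_iff_odd] at hn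
    rw [Int.negOnePow_odd _ ⟨k, by push_cast; ring⟩,
      Int.negOnePow_even _ ⟨k, by push_cast; ring⟩] at ci
    push_cast at ci
    linarith
  · set m := M i j with hm
    have hθ := sin_two_pi_div_ne_zero h3
    have hpi := Real.pi_pos
    have hm3 : (3 : ℝ) ≤ m := by exact_mod_cast h3
    have hcos : Real.cos (Real.pi / m) ≠ 0 := by
      intro h0
      apply hθ
      rw [mul_div_assoc, Real.sin_two_mul, h0, mul_zero]
    simp only [hcos, or_false] at cj
    rw [cj, add_zero, eval_S_two_mul_cos hθ, eq_comm, div_eq_one_iff_eq hθ] at ci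
    rw [eval_S_two_mul_cos hθ, div_eq_zero_iff, or_iff_left hθ] at cj
    push_cast at ci cj
    rw [sub_add_cancel] at cj
    rw [add_mul, Real.sin_add, cj, zero_mul, zero_add, one_mul, mul_eq_right₀ hθ,
      Real.cos_eq_one_iff] at ci
    obtain ⟨k, hk⟩ := ci
    have : (k : ℝ) * m = n := by
      field_simp at hk
      linarith
    have : k * (m : ℤ) = n := by exact_mod_cast this
    exact_mod_cast Dvd.intro_left k this

theorem orderOf_simple_mul_simple (i j : B) : orderOf (cs.simple i * cs.simple j) = M i j :=
  Nat.dvd_antisymm (orderOf_dvd_of_pow_eq_one (cs.simple_mul_simple_pow i j))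
    (cs.dvd_of_simple_mul_simple_pow_eq_one (pow_orderOf_eq_one _))

/-- The elements of `W` which act trivially on the quotient of the geometric representation by
the subspace `P`. -/
def fixingModulo (P : Submodule ℝ (B →₀ ℝ)) : Subgroup W where
  carrier := {w | ∀ v, cs.geometricRep w v - v ∈ P}
  one_mem' v := by simp
  mul_mem' {w w'} hw hw' v := by
    have := P.add_mem (hw (cs.geometricRep w' v)) (hw' v)
    rwa [sub_add_sub_cancel, ← LinearEquiv.mul_apply, ← map_mul] at this
  inv_mem' {w} hw v := by
    have := P.neg_mem (hw (cs.geometricRep w⁻¹ v))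
    rwa [← LinearEquiv.mul_apply, ← map_mul, mul_inv_cancel, map_one, neg_sub] at this

/-- Among three simple reflections in a conjugate of a dihedral parabolic subgroup, two
coincide. -/
theorem exists_subgroup_not_three_simple (e : W) (x y : B) :
    ∃ H : Subgroup W, e * cs.simple x * e⁻¹ ∈ H ∧ e * cs.simple y * e⁻¹ ∈ H ∧
      ∀ p q r : B, cs.simple p ∈ H → cs.simple q ∈ H → cs.simple r ∈ H →
        p = q ∨ p = r ∨ q = r := by
  set P : Submodule ℝ (B →₀ ℝ) := Submodule.span ℝ
    {cs.geometricRep e (Finsupp.single x 1), cs.geometricRep e (Finsupp.single y 1)} with hP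
  have conj_mem : ∀ z, cs.geometricRep e (Finsupp.single z 1) ∈ P →
      e * cs.simple z * e⁻¹ ∈ cs.fixingModulo P := by
    intro z hz v
    have : cs.geometricRep (e * cs.simple z * e⁻¹) v - v =
        -(M.coroot z (cs.geometricRep e⁻¹ v)) • cs.geometricRep e (Finsupp.single z 1) := by
      rw [map_mul, map_mul, LinearEquiv.mul_apply, LinearEquiv.mul_apply, geometricRep_simple,
        map_sub, map_smul, ← LinearEquiv.mul_apply, ← map_mul, mul_inv_cancel, map_one]
      simp
    rw [this]
    exact P.smul_mem _ hz
  refine ⟨cs.fixingModulo P, conj_mem x (Submodule.subset_span (by simp)),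
    conj_mem y (Submodule.subset_span (by simp)), ?_⟩
  have mem_P : ∀ p, cs.simple p ∈ cs.fixingModulo P → Finsupp.single p 1 ∈ P := by
    intro p hp
    have := P.smul_mem (-(1 / 2 : ℝ)) (hp (Finsupp.single p 1))
    -- s_p α_p − α_p = −2α_p, whence the factor −1/2. The plane `P` contains at most two of the
    -- independent vectors α_p.
    rw [geometricRep_simple_self] at this
    convert! this using 1
    module
  intro p q r hp hq hr
  by_contra! hne
  have hinj : Function.Injective ![p, q, r] := by
    intro a b
    fin_cases a <;> fin_cases b <;> simp [hne, hne.1.symm, hne.2.1.symm, hne.2.2.symm]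
  have hli : LinearIndependent ℝ fun a : Fin 3 => Finsupp.single (![p, q, r] a) (1 : ℝ) :=
    (Finsupp.linearIndependent_single_one ℝ B).comp _ hinj
  have hle : Submodule.span ℝ (Set.range fun a : Fin 3 => Finsupp.single (![p, q, r] a) (1 : ℝ))
      ≤ P := by
    rw [Submodule.span_le]
    rintro _ ⟨a, rfl⟩
    fin_cases a
    exacts [mem_P p hp, mem_P q hq, mem_P r hr]
  have h3 := finrank_span_eq_card hli
  have : FiniteDimensional ℝ P := FiniteDimensional.span_of_finite ℝ (Set.toFinite _)
  have h4 := Submodule.finrank_mono hle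
  classical
  have h5 : Module.finrank ℝ P ≤ 2 := by
    refine (finrank_span_le_card (R := ℝ) _).trans ?_
    rw [Set.toFinset_insert, Set.toFinset_singleton]
    exact Finset.card_le_two
  simp at h3
  omega

end CoxeterSystem

namespace CoxeterSystem

variable {B W : Type*} [Group W] {M : CoxeterMatrix B} (cs : CoxeterSystem M W)

/-! ### The parity of the number of occurrences of a reflection in an inversion sequence -/

open Classical in
/-- The action of a simple reflection `s i` on pairs of a group element and a sign: the element is
conjugated by `s i`, and the sign is changed if the element is `s i`. -/
noncomputable def signedConj (i : B) : Equiv.Perm (W × ZMod 2) :=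
  Function.Involutive.toPerm
    (fun p => (cs.simple i * p.1 * cs.simple i, p.2 + if p.1 = cs.simple i then 1 else 0)) (by
      rintro ⟨t, ε⟩
      have h : cs.simple i * t * cs.simple i = cs.simple i ↔ t = cs.simple i := by
        rw [mul_assoc, mul_eq_left, mul_eq_one_iff_eq_inv, inv_simple]
      ext
      · simp [mul_assoc]
      · simp [h, add_assoc, CharTwo.add_self_eq_zero])

open Classical in
theorem signedConj_apply (i : B) (t : W) (ε : ZMod 2) :
    cs.signedConj i (t, ε) =
      (cs.simple i * t * cs.simple i, ε + if t = cs.simple i then 1 else 0) := rfl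

open Classical in
theorem signedConj_mul_signedConj_pow_apply (i j : B) (t : W) (ε : ZMod 2) (n : ℕ) :
    ((cs.signedConj i * cs.signedConj j) ^ n) (t, ε) =
      ((cs.simple i * cs.simple j) ^ n * t * (cs.simple j * cs.simple i) ^ n,
        ε + ∑ k ∈ Finset.range (2 * n),
          if t = (cs.simple j * cs.simple i) ^ k * cs.simple j then 1 else 0) := by
  induction n with
  | zero => simp
  | succ n ih =>
    have hinv : ∀ k, ((cs.simple j * cs.simple i) ^ k)⁻¹ = (cs.simple i * cs.simple j) ^ k := by
      intro k
      rw [← inv_pow, mul_inv_rev, inv_simple, inv_simple]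
    have hcomm : ∀ k, cs.simple j * (cs.simple i * cs.simple j) ^ k =
        (cs.simple j * cs.simple i) ^ k * cs.simple j := by
      intro k
      induction k with
      | zero => simp
      | succ k ihk =>
        rw [pow_succ', pow_succ', ← mul_assoc, ← mul_assoc, mul_assoc (_ * _), ihk,
          mul_assoc (_ * _) _ (cs.simple j)]
    have h1 : (cs.simple i * cs.simple j) ^ n * t * (cs.simple j * cs.simple i) ^ n =
        cs.simple j ↔ t = (cs.simple j * cs.simple i) ^ (2 * n) * cs.simple j := by
      rw [← eq_mul_inv_iff_mul_eq, hinv, hcomm, ← hinv, inv_mul_eq_iff_eq_mul, two_mul, pow_add,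
        mul_assoc]
    have h2 : cs.simple j * ((cs.simple i * cs.simple j) ^ n * t *
        (cs.simple j * cs.simple i) ^ n) * cs.simple j =
        cs.simple i ↔ t = (cs.simple j * cs.simple i) ^ (2 * n + 1) * cs.simple j := by
      have e : (cs.simple j * cs.simple i) ^ (2 * n + 1) * cs.simple j =
          (cs.simple j * cs.simple i) ^ n * (cs.simple j * cs.simple i * cs.simple j *
            ((cs.simple j * cs.simple i) ^ n)⁻¹) := by
        rw [show 2 * n + 1 = n + 1 + n by ring, pow_add, pow_succ, mul_assoc _ _ (cs.simple j),
          ← hcomm, hinv]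
        simp only [mul_assoc]
      rw [e, ← hinv, ← inv_mul_eq_iff_eq_mul, eq_mul_inv_iff_mul_eq, ← eq_mul_inv_iff_mul_eq,
        inv_simple, ← eq_inv_mul_iff_mul_eq, inv_simple, mul_assoc (cs.simple j)]
    rw [pow_succ', Equiv.Perm.mul_apply, ih, Equiv.Perm.mul_apply, signedConj_apply,
      signedConj_apply]
    ext1
    · dsimp only
      rw [pow_succ', pow_succ]
      simp only [mul_assoc]
    · dsimp only
      rw [mul_add, mul_one, Finset.sum_range_succ, Finset.sum_range_succ]
      simp only [h1, h2, add_assoc]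

/-- The 2m reflections (sⱼsᵢ)ᵏsⱼ repeat with period m = `M i j`, so the sign changes an even number
of times. -/
theorem signedConj_isLiftable : M.IsLiftable cs.signedConj := by
  classical
  intro i j
  ext1 ⟨t, ε⟩
  rw [signedConj_mul_signedConj_pow_apply, cs.simple_mul_simple_pow, cs.simple_mul_simple_pow',
    two_mul, Finset.sum_range_add]
  simp [pow_add, CharTwo.add_self_eq_zero]

/-- The parity of the number of occurrences of `t` in the left inversion sequence of any word
representing `w`. -/
noncomputable def parity (w t : W) : ZMod 2 :=
  (cs.lift ⟨cs.signedConj, cs.signedConj_isLiftable⟩ w⁻¹ (t, 0)).2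

open Classical in
theorem lift_signedConj_apply (ω : List B) (t : W) (ε : ZMod 2) :
    cs.lift ⟨cs.signedConj, cs.signedConj_isLiftable⟩ (cs.wordProd ω)⁻¹ (t, ε) =
      ((cs.wordProd ω)⁻¹ * t * cs.wordProd ω, ε + (cs.leftInvSeq ω).count t) := by
  induction ω generalizing t ε with
  | nil => simp
  | cons i ω ih =>
    have hcount : List.count (cs.simple i * t * cs.simple i) (cs.leftInvSeq ω) =
        List.count t ((cs.leftInvSeq ω).map (MulAut.conj (cs.simple i))) := by
      rw [← List.count_map_of_injective _ _ (MulAut.conj (cs.simple i)).injective]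
      congr 1
      simp [mul_assoc]
    rw [wordProd_cons, mul_inv_rev, inv_simple, map_mul, Equiv.Perm.mul_apply, lift_apply_simple,
      signedConj_apply, ih, leftInvSeq, List.count_cons, hcount]
    ext1
    · simp [mul_assoc]
    · simp only [beq_iff_eq, eq_comm (a := cs.simple i)]
      push_cast
      ring

open Classical in
theorem parity_wordProd (ω : List B) (t : W) :
    cs.parity (cs.wordProd ω) t = (cs.leftInvSeq ω).count t := by
  rw [parity, lift_signedConj_apply, zero_add]

theorem parity_one (t : W) : cs.parity 1 t = 0 := by
  classical
  simpa using cs.parity_wordProd [] t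

open Classical in
theorem parity_simple (i : B) (t : W) :
    cs.parity (cs.simple i) t = if cs.simple i = t then 1 else 0 := by
  have h := cs.parity_wordProd [i] t
  rw [wordProd_singleton] at h
  simp [h, List.count_singleton]

theorem parity_mul (u v t : W) :
    cs.parity (u * v) t = cs.parity u t + cs.parity v (u⁻¹ * t * u) := by
  classical
  obtain ⟨ω, rfl⟩ := cs.wordProd_surjective u
  obtain ⟨ω', rfl⟩ := cs.wordProd_surjective v
  rw [parity, mul_inv_rev, map_mul, Equiv.Perm.mul_apply, lift_signedConj_apply,
    lift_signedConj_apply, parity_wordProd, parity_wordProd, zero_add]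

/-- Every word can be shortened to a word with the same product and without repetitions in its
left inversion sequence. -/
theorem exists_nodup_leftInvSeq (ω : List B) :
    ∃ ω' : List B, ω' ⊆ ω ∧ cs.wordProd ω' = cs.wordProd ω ∧ (cs.leftInvSeq ω').Nodup := by
  induction hn : ω.length using Nat.strong_induction_on generalizing ω with
  | _ n ih =>
    subst hn
    by_cases hω : (cs.leftInvSeq ω).Nodup
    · exact ⟨ω, List.Subset.refl _, rfl, hω⟩
    rw [List.nodup_iff_getElem?_ne_getElem?] at hω
    push Not at hω
    obtain ⟨j, k, hjk, hk, heq⟩ := hω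
    have hk' : k < ω.length := by simpa using hk
    rw [List.getElem?_eq_getElem (by omega), List.getElem?_eq_getElem hk, Option.some_inj,
      ← List.getD_eq_getElem _ 1, ← List.getD_eq_getElem _ 1] at heq
    -- Erasing a letter multiplies the product on the left by the inversion at that place. As j < k,
    -- erasing the k-th letter leaves the j-th inversion unchanged, and the two equal involutions
    -- cancel.
    have hprod : cs.wordProd ((ω.eraseIdx k).eraseIdx j) = cs.wordProd ω := by
      have h1 : (cs.leftInvSeq (ω.eraseIdx k)).getD j 1 = (cs.leftInvSeq ω).getD j 1 := by
        rw [getD_leftInvSeq, getD_leftInvSeq]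
        have ht : (ω.eraseIdx k).take j = ω.take j := by
          rw [List.take_eraseIdx_eq_take_of_le _ _ _ hjk.le]
        have hg : (ω.eraseIdx k)[j]? = ω[j]? := List.getElem?_eraseIdx_of_lt hjk
        rw [ht, hg]
      rw [← getD_leftInvSeq_mul_wordProd, h1, ← getD_leftInvSeq_mul_wordProd, heq, ← mul_assoc,
        getD_leftInvSeq_mul_self, one_mul]
    obtain ⟨ω', hsub, hp, hnd⟩ := ih ((ω.eraseIdx k).eraseIdx j).length
      (by grind) _ rfl
    exact ⟨ω', List.Subset.trans hsub (List.Subset.trans (List.eraseIdx_subset ..) (List.eraseIdx_subset ..)),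
      hp.trans hprod, hnd⟩

/-! ### Minimal coset representatives of a parabolic subgroup -/

/-- The parabolic subgroup generated by the simple reflections indexed by `T`. -/
def parabolic (T : Set B) : Subgroup W :=
  Subgroup.closure (cs.simple '' T)

variable {T : Set B}

theorem simple_mem_parabolic {i : B} (hi : i ∈ T) : cs.simple i ∈ cs.parabolic T :=
  Subgroup.subset_closure (Set.mem_image_of_mem _ hi)

theorem wordProd_mem_parabolic {ω : List B} (hω : ∀ i ∈ ω, i ∈ T) :
    cs.wordProd ω ∈ cs.parabolic T := by
  refine Subgroup.list_prod_mem _ ?_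
  simp only [List.mem_map]
  rintro _ ⟨i, hi, rfl⟩
  exact cs.simple_mem_parabolic (hω i hi)

theorem exists_word_of_mem_parabolic {w : W} (hw : w ∈ cs.parabolic T) :
    ∃ ω : List B, (∀ i ∈ ω, i ∈ T) ∧ cs.wordProd ω = w := by
  induction hw using Subgroup.closure_induction with
  | mem x hx =>
    obtain ⟨i, hi, rfl⟩ := hx
    exact ⟨[i], by simpa using hi, by simp⟩
  | one => exact ⟨[], by simp, by simp⟩
  | mul x y _ _ hx hy =>
    obtain ⟨ω, hω, rfl⟩ := hx
    obtain ⟨ω', hω', rfl⟩ := hy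
    exact ⟨ω ++ ω', by grind, by simp [wordProd_append]⟩
  | inv x _ hx =>
    obtain ⟨ω, hω, rfl⟩ := hx
    exact ⟨ω.reverse, by grind, by simp⟩

theorem exists_nodup_word_of_mem_parabolic {w : W} (hw : w ∈ cs.parabolic T) :
    ∃ ω : List B, (∀ i ∈ ω, i ∈ T) ∧ cs.wordProd ω = w ∧ (cs.leftInvSeq ω).Nodup := by
  obtain ⟨ω, hω, rfl⟩ := cs.exists_word_of_mem_parabolic hw
  obtain ⟨ω', hsub, hp, hnd⟩ := cs.exists_nodup_leftInvSeq ω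
  exact ⟨ω', fun i hi => hω i (hsub hi), hp, hnd⟩

theorem mem_parabolic_of_mem_leftInvSeq {ω : List B} (hω : ∀ i ∈ ω, i ∈ T) {t : W}
    (ht : t ∈ cs.leftInvSeq ω) : t ∈ cs.parabolic T := by
  induction ω generalizing t with
  | nil => simp at ht
  | cons i ω ih =>
    have hi := cs.simple_mem_parabolic (hω i List.mem_cons_self)
    rw [leftInvSeq, List.mem_cons, List.mem_map] at ht
    obtain rfl | ⟨t, ht, rfl⟩ := ht
    · exact hi
    · exact mul_mem (mul_mem hi (ih (fun j hj => hω j (List.mem_cons_of_mem _ hj)) ht))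
        (inv_mem hi)

/-- The minimal representatives of the cosets `W_T e`. -/
def minimalReps (T : Set B) : Set W :=
  {e | ∀ t ∈ cs.parabolic T, cs.parity e t = 0}

theorem one_mem_minimalReps : (1 : W) ∈ cs.minimalReps T := fun t _ => cs.parity_one t

/-- In a nonempty word over `T` without repeated inversions, the first letter is an inversion of
parity 1. -/
theorem eq_one_of_parity_eq_zero {v : W} (hv : v ∈ cs.parabolic T)
    (h : ∀ t ∈ cs.parabolic T, cs.parity v t = 0) : v = 1 := by
  classical
  obtain ⟨ω, hω, rfl, hnd⟩ := cs.exists_nodup_word_of_mem_parabolic hv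
  cases ω with
  | nil => simp
  | cons i ω =>
    have := h (cs.simple i) (cs.simple_mem_parabolic (hω i List.mem_cons_self))
    rw [parity_wordProd, List.count_eq_one_of_mem hnd (by simp [leftInvSeq])] at this
    simp at this

theorem eq_of_mem_minimalReps {e e' v : W} (he : e ∈ cs.minimalReps T)
    (he' : e' ∈ cs.minimalReps T) (hv : v ∈ cs.parabolic T) (h : e' = v * e) : e' = e := by
  rw [cs.eq_one_of_parity_eq_zero hv, one_mul] at h
  · exact h
  · intro t ht
    have h0 := he' t ht
    rwa [h, parity_mul, he _ (mul_mem (mul_mem (inv_mem hv) ht) hv), add_zero] at h0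

/-- The parities of e and e sᵢ differ only at the reflection e sᵢ e⁻¹. -/
theorem mul_simple_mem_minimalReps {e : W} (he : e ∈ cs.minimalReps T) {i : B}
    (h : e * cs.simple i * e⁻¹ ∉ cs.parabolic T) : e * cs.simple i ∈ cs.minimalReps T := by
  intro t ht
  rw [parity_mul, he t ht, parity_simple, if_neg, add_zero]
  rintro h'
  apply h
  rwa [h', mul_assoc, mul_assoc, mul_inv_cancel, mul_one, mul_inv_cancel_left]

/-- A reflection `e * s i * e⁻¹` in `W_T`, with `e` a minimal coset representative, is simple. -/
theorem exists_eq_simple_of_mem_parabolic {e : W} (he : e ∈ cs.minimalReps T) {i : B}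
    (h : e * cs.simple i * e⁻¹ ∈ cs.parabolic T) :
    ∃ j ∈ T, e * cs.simple i * e⁻¹ = cs.simple j := by
  classical
  set r := e * cs.simple i * e⁻¹ with hr
  -- Compute the parity of r e = e sᵢ in two ways; e itself contributes nothing on W_T.
  have key : ∀ t ∈ cs.parabolic T, cs.parity r t = if r = t then 1 else 0 := by
    intro t ht
    have h1 : cs.parity (r * e) t = cs.parity r t := by
      rw [parity_mul, he _ (mul_mem (mul_mem (inv_mem h) ht) h), add_zero]
    have h2 : r * e = e * cs.simple i := by simp [hr]
    rw [← h1, h2, parity_mul, he t ht, parity_simple, zero_add, hr]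
    congr 1
    rw [eq_iff_iff, mul_inv_eq_iff_eq_mul, mul_assoc, eq_inv_mul_iff_mul_eq]
  obtain ⟨ω, hω, hp, hnd⟩ := cs.exists_nodup_word_of_mem_parabolic h
  -- A repetition-free word over `T` for r has no inversion other than r, so its length is at most
  -- one.
  have hall : ∀ t ∈ cs.leftInvSeq ω, t = r := by
    intro t ht
    by_contra hne
    have := key t (cs.mem_parabolic_of_mem_leftInvSeq hω ht)
    rw [← hp, parity_wordProd, List.count_eq_one_of_mem hnd ht, hp, if_neg (Ne.symm hne)] at this
    simp at this
  match ω, hω, hp, hnd, hall with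
  | [], _, hp, _, _ =>
    have := key 1 (one_mem _)
    rw [← hp] at this
    simp [parity_one] at this
  | [j], hω, hp, _, _ => exact ⟨j, hω j (by simp), by rw [← hp]; simp⟩
  | j :: k :: ω, _, _, hnd, hall =>
    exfalso
    simp only [leftInvSeq, List.map_cons, List.nodup_cons, List.mem_cons] at hnd hall
    exact hnd.1 (Or.inl ((hall _ (Or.inl rfl)).trans (hall _ (Or.inr (Or.inl rfl))).symm))

end CoxeterSystem

/-! ### Alternating words and the two sides of a braid relation -/

/-- The alternating word `x y x ⋯` with `n` letters. -/
def alternatingList {B : Type*} (x y : B) : ℕ → List B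
  | 0 => []
  | n + 1 => x :: alternatingList y x n

theorem mem_alternatingList {B : Type*} {x y z : B} {n : ℕ} (h : z ∈ alternatingList x y n) :
    z = x ∨ z = y := by
  induction n generalizing x y with
  | zero => simp [alternatingList] at h
  | succ n ih =>
    rw [alternatingList, List.mem_cons] at h
    exact h.elim Or.inl fun h => (ih h).symm

theorem prod_map_alternatingList {B : Type*} {K : Type u} [Group K] (κ : B → K) (x y : B) (n : ℕ) :
    ((alternatingList x y n).map κ).prod = alternatingProd (κ x) (κ y) n := by
  induction n generalizing x y with
  | zero => rfl
  | succ n ih => simp [alternatingList, alternatingProd, ih]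

theorem alternatingProd_eq_pow_mul {G : Type u} [Group G] {a b : G} (ha : a * a = 1)
    (hb : b * b = 1) (n : ℕ) :
    alternatingProd a b n = (a * b) ^ n * alternatingProd b a n := by
  induction n generalizing a b with
  | zero => simp [alternatingProd]
  | succ n ih =>
    have h : ∀ k, a * (b * a) ^ k = (a * b) ^ k * a := by
      intro k
      induction k with
      | zero => simp
      | succ k ihk =>
        rw [pow_succ', pow_succ', ← mul_assoc, ← mul_assoc, mul_assoc (_ * _), ihk,
          mul_assoc (_ * _) _ a]
    rw [alternatingProd, alternatingProd, ih hb ha, ← mul_assoc, h, pow_succ]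
    simp only [mul_assoc]
    rw [← mul_assoc b b, hb, one_mul]

namespace CoxeterSystem

variable {B : Type*} {W : Type u} [Group W] {M : CoxeterMatrix B} (cs : CoxeterSystem M W)

theorem wordProd_alternatingList_comm (x y : B) :
    cs.wordProd (alternatingList x y (M x y)) = cs.wordProd (alternatingList y x (M x y)) := by
  rw [wordProd, wordProd, prod_map_alternatingList, prod_map_alternatingList,
    alternatingProd_eq_pow_mul (cs.simple_mul_simple_self x) (cs.simple_mul_simple_self y),
    simple_mul_simple_pow, one_mul]

theorem leftInvSeq_alternatingList (x y : B) (n : ℕ) :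
    cs.leftInvSeq (alternatingList x y n) =
      (List.range n).map fun k => (cs.simple x * cs.simple y) ^ k * cs.simple x := by
  induction n generalizing x y with
  | zero => rfl
  | succ n ih =>
    rw [alternatingList, leftInvSeq, ih, List.range_succ_eq_map]
    simp only [List.map_cons, List.map_map, pow_zero, one_mul, List.cons.injEq, true_and]
    refine List.map_congr_left fun k _ => ?_
    simp only [Function.comp_apply, MulAut.conj_apply, inv_simple, Nat.succ_eq_add_one]
    have h : ∀ k, cs.simple x * (cs.simple y * cs.simple x) ^ k =
        (cs.simple x * cs.simple y) ^ k * cs.simple x := by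
      intro k
      induction k with
      | zero => simp
      | succ k ihk =>
        rw [pow_succ', pow_succ', ← mul_assoc, ← mul_assoc, mul_assoc (_ * _), ihk,
          mul_assoc (_ * _) _ (cs.simple x)]
    rw [← mul_assoc, h, pow_succ]
    simp only [mul_assoc]

/-- Since (xy)ᵐ = 1, the k-th inversion (yx)ᵏy equals (xy)^(m−1−k)x. -/
theorem leftInvSeq_alternatingList_comm (x y : B) :
    cs.leftInvSeq (alternatingList y x (M x y)) =
      (cs.leftInvSeq (alternatingList x y (M x y))).reverse := by
  rw [leftInvSeq_alternatingList, leftInvSeq_alternatingList]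
  refine List.ext_getElem (by simp) fun k hk _ => ?_
  have hk' : k < M x y := by simpa using hk
  simp only [List.getElem_map, List.getElem_range, List.getElem_reverse, List.length_map,
    List.length_range]
  have hinv : (cs.simple y * cs.simple x) ^ k = ((cs.simple x * cs.simple y) ^ k)⁻¹ := by
    rw [← inv_pow, mul_inv_rev, inv_simple, inv_simple]
  rw [hinv, inv_mul_eq_iff_eq_mul, ← mul_assoc, ← pow_add, ← mul_inv_eq_iff_eq_mul, inv_simple]
  have h1 : k + (M x y - 1 - k) + 1 = M x y := by omega
  have h2 := cs.simple_mul_simple_pow x y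
  rw [← h1, pow_succ, mul_eq_one_iff_eq_inv, mul_inv_rev, inv_simple, inv_simple] at h2
  exact h2.symm

/-- This uses that the order of the product of the two simple reflections is exactly `M x y`, not a
proper divisor. -/
theorem nodup_leftInvSeq_alternatingList (x y : B) :
    (cs.leftInvSeq (alternatingList x y (M x y))).Nodup := by
  rw [leftInvSeq_alternatingList]
  refine List.Nodup.map_on ?_ List.nodup_range
  intro k hk l hl h
  rw [List.mem_range, ← cs.orderOf_simple_mul_simple] at hk hl
  exact pow_injOn_Iio_orderOf hk hl (mul_right_cancel h)

theorem nodup_leftInvSeq_of_cons {i : B} {ω : List B} (h : (cs.leftInvSeq (i :: ω)).Nodup) :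
    (cs.leftInvSeq ω).Nodup :=
  (List.nodup_cons.1 h).2.of_map _

/-- A word in two letters whose left inversion sequence has no repetitions is alternating. -/
theorem eq_alternatingList_of_nodup {p q : B} {ω : List B} (hpq : ∀ z ∈ ω, z = p ∨ z = q)
    (hhead : ∀ z ∈ ω.head?, z = p) (h : (cs.leftInvSeq ω).Nodup) :
    ω = alternatingList p q ω.length := by
  induction ω generalizing p q with
  | nil => rfl
  | cons z ω ih =>
    obtain rfl : z = p := hhead z (by simp)
    rw [List.length_cons, alternatingList, List.cons_inj_right]
    refine ih (fun z hz => (hpq z (List.mem_cons_of_mem _ hz)).symm) ?_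
      (cs.nodup_leftInvSeq_of_cons h)
    intro z' hz'
    cases ω with
    | nil => simp at hz'
    | cons a ω =>
      obtain rfl : a = z' := by simpa using hz'
      refine (hpq a (by simp)).resolve_left ?_
      rintro rfl
      simp [leftInvSeq] at h

/-- The only relation between two words with mutually reverse left inversion sequences in which
at most two letters occur is the braid relation. -/
theorem prod_map_eq_of_leftInvSeq_eq_reverse {K : Type v} [Group K] (κ : B → K) {T : Set B}
    (hκ : ∀ p ∈ T, ∀ q ∈ T, p ≠ q → M p q ≠ 0 →
      alternatingProd (κ p) (κ q) (M p q) = alternatingProd (κ q) (κ p) (M p q))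
    {ω ω' : List B} (hT : ∀ z ∈ ω, z ∈ T) {S : Set B} (hω : ∀ z ∈ ω, z ∈ S) (hω' : ∀ z ∈ ω', z ∈ S)
    (hS : ∀ p ∈ S, ∀ q ∈ S, ∀ r ∈ S, p = q ∨ p = r ∨ q = r)
    (hnd : (cs.leftInvSeq ω).Nodup) (hrev : cs.leftInvSeq ω' = (cs.leftInvSeq ω).reverse) :
    (ω.map κ).prod = (ω'.map κ).prod := by
  have hnd' : (cs.leftInvSeq ω').Nodup := by rwa [hrev, List.nodup_reverse]
  have hlen : ω'.length = ω.length := by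
    have := congrArg List.length hrev
    simpa using this
  match ω, hT, hω, hnd, hrev, hlen with
  | [], _, _, _, _, hlen =>
    rw [List.length_nil, List.length_eq_zero_iff] at hlen
    rw [hlen]
  | [p], _, _, _, hrev, hlen =>
    rw [List.length_singleton, List.length_eq_one_iff] at hlen
    obtain ⟨p', rfl⟩ := hlen
    have : p' = p := cs.simple_injective (by simpa using hrev)
    rw [this]
  | p :: q :: ω, hT, hω, hnd, hrev, hlen =>
    have hpq : p ≠ q := by
      rintro rfl
      simp [leftInvSeq] at hnd
    have hS' : ∀ z ∈ S, z = p ∨ z = q := by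
      intro z hz
      have := hS z hz p (hω p (by simp)) q (hω q (by simp))
      tauto
    have h1 := cs.eq_alternatingList_of_nodup (p := p) (q := q) (fun z hz => hS' z (hω z hz))
      (by simp) hnd
    set j := (p :: q :: ω).length with hj
    have hj2 : 2 ≤ j := by simp [hj]
    rw [h1] at hrev hnd ⊢
    have hhead : (cs.leftInvSeq ω').head? =
        some ((cs.simple p * cs.simple q) ^ (j - 1) * cs.simple p) := by
      rw [hrev, leftInvSeq_alternatingList, List.head?_reverse, List.getLast?_map,
        List.getLast?_range, if_neg (by omega), Option.map_some]
    rw [leftInvSeq_alternatingList] at hnd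
    have hinj : ∀ k < j, ∀ l < j, (cs.simple p * cs.simple q) ^ k * cs.simple p =
        (cs.simple p * cs.simple q) ^ l * cs.simple p → k = l := fun k hk l hl =>
      List.inj_on_of_nodup_map hnd (List.mem_range.2 hk) (List.mem_range.2 hl)
    -- If `ω'` began with p, then s_p would be both the first and the last inversion of `ω`, against
    -- distinctness, as j ≥ 2.
    have h2 : ω' = alternatingList q p j := by
      rw [← hlen]
      refine cs.eq_alternatingList_of_nodup (fun z hz => (hS' z (hω' z hz)).symm) ?_ hnd'
      intro z hz
      refine (hS' z (hω' z (List.mem_of_mem_head? hz))).resolve_left ?_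
      rintro rfl
      obtain ⟨μ, rfl⟩ : ∃ μ, ω' = z :: μ := by
        cases ω' with
        | nil => simp at hz
        | cons a μ => exact ⟨μ, by simpa using hz⟩
      have := hinj 0 (by omega) (j - 1) (by omega) (by simpa [leftInvSeq] using hhead)
      omega
    obtain ⟨i, hi⟩ : ∃ i, j = i + 1 := ⟨j - 1, by omega⟩
    rw [h2, hi, alternatingList, leftInvSeq, List.head?_cons, Option.some_inj,
      Nat.add_sub_cancel] at hhead
    rw [h2]
    rw [prod_map_alternatingList, prod_map_alternatingList]
    -- The first inversion s_q of `ω'` is the last one of `ω`. This makes j a multiple of `M p q`,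
    -- and distinctness of the inversions gives j ≤ `M p q`.
    have hone : (cs.simple p * cs.simple q) ^ j = 1 := by
      rw [hi, pow_succ, ← mul_assoc, ← hhead, simple_mul_simple_self]
    have hdvd := cs.dvd_of_simple_mul_simple_pow_eq_one hone
    have hM0 : M p q ≠ 0 := by
      intro h0
      rw [h0, zero_dvd_iff] at hdvd
      omega
    have hjM : j = M p q := by
      refine le_antisymm ?_ (Nat.le_of_dvd (by omega) hdvd)
      by_contra! hlt
      exact hM0 (hinj 0 (by omega) _ hlt (by simp)).symm
    rw [hjM]
    exact hκ p (hT p (by simp)) q (hT q (by simp)) hpq hM0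

/-! ### Projecting paths to a parabolic subgroup -/

variable (T : Set B)

open Classical in
/-- The labels of the loops met when the word `ω` acts on the coset `W_T e`. -/
noncomputable def pathLabels : List B → W → List B
  | [], _ => []
  | i :: ω, e =>
    if h : ∃ j ∈ T, e * cs.simple i * e⁻¹ = cs.simple j then h.choose :: pathLabels ω e
    else pathLabels ω (e * cs.simple i)

open Classical in
/-- The minimal representative of the coset at which the word `ω` arrives from `W_T e`. -/
noncomputable def pathEnd : List B → W → W
  | [], e => e
  | i :: ω, e =>
    if ∃ j ∈ T, e * cs.simple i * e⁻¹ = cs.simple j then pathEnd ω e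
    else pathEnd ω (e * cs.simple i)

variable {T}

theorem choose_eq {w : W} {j : B} (h : w = cs.simple j)
    (h' : ∃ j ∈ T, w = cs.simple j) : h'.choose = j :=
  cs.simple_injective (h'.choose_spec.2.symm.trans h)

theorem pathLabels_cons_of_eq {e : W} {i j : B} (hj : j ∈ T)
    (h : e * cs.simple i * e⁻¹ = cs.simple j) (ω : List B) :
    cs.pathLabels T (i :: ω) e = j :: cs.pathLabels T ω e := by
  have h' : ∃ j ∈ T, e * cs.simple i * e⁻¹ = cs.simple j := ⟨j, hj, h⟩
  rw [pathLabels, dif_pos h', cs.choose_eq h h']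

theorem pathLabels_cons_of_not {e : W} {i : B}
    (h : ¬ ∃ j ∈ T, e * cs.simple i * e⁻¹ = cs.simple j) (ω : List B) :
    cs.pathLabels T (i :: ω) e = cs.pathLabels T ω (e * cs.simple i) := by
  rw [pathLabels, dif_neg h]

theorem pathEnd_cons_of_eq {e : W} {i j : B} (hj : j ∈ T)
    (h : e * cs.simple i * e⁻¹ = cs.simple j) (ω : List B) :
    cs.pathEnd T (i :: ω) e = cs.pathEnd T ω e := by
  rw [pathEnd, if_pos ⟨j, hj, h⟩]

theorem pathEnd_cons_of_not {e : W} {i : B}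
    (h : ¬ ∃ j ∈ T, e * cs.simple i * e⁻¹ = cs.simple j) (ω : List B) :
    cs.pathEnd T (i :: ω) e = cs.pathEnd T ω (e * cs.simple i) := by
  rw [pathEnd, if_neg h]

theorem mul_simple_mem_minimalReps_of_not {e : W} (he : e ∈ cs.minimalReps T) {i : B}
    (h : ¬ ∃ j ∈ T, e * cs.simple i * e⁻¹ = cs.simple j) :
    e * cs.simple i ∈ cs.minimalReps T :=
  cs.mul_simple_mem_minimalReps he fun h' => h (cs.exists_eq_simple_of_mem_parabolic he h')

theorem mem_of_mem_pathLabels {ω : List B} {e : W} {z : B} (hz : z ∈ cs.pathLabels T ω e) :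
    z ∈ T := by
  induction ω generalizing e with
  | nil => simp [pathLabels] at hz
  | cons i ω ih =>
    by_cases h : ∃ j ∈ T, e * cs.simple i * e⁻¹ = cs.simple j
    · obtain ⟨j, hj, hij⟩ := h
      rw [cs.pathLabels_cons_of_eq hj hij, List.mem_cons] at hz
      exact hz.elim (fun h => h ▸ hj) ih
    · rw [cs.pathLabels_cons_of_not h] at hz
      exact ih hz

theorem pathEnd_mem_minimalReps {e : W} (he : e ∈ cs.minimalReps T) (ω : List B) :
    cs.pathEnd T ω e ∈ cs.minimalReps T := by
  induction ω generalizing e with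
  | nil => exact he
  | cons i ω ih =>
    by_cases h : ∃ j ∈ T, e * cs.simple i * e⁻¹ = cs.simple j
    · obtain ⟨j, hj, hij⟩ := h
      rw [cs.pathEnd_cons_of_eq hj hij]
      exact ih he
    · rw [cs.pathEnd_cons_of_not h]
      exact ih (cs.mul_simple_mem_minimalReps_of_not he h)

theorem mul_wordProd_eq (ω : List B) (e : W) :
    e * cs.wordProd ω = cs.wordProd (cs.pathLabels T ω e) * cs.pathEnd T ω e := by
  induction ω generalizing e with
  | nil => simp [pathLabels, pathEnd]
  | cons i ω ih =>
    by_cases h : ∃ j ∈ T, e * cs.simple i * e⁻¹ = cs.simple j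
    · obtain ⟨j, hj, hij⟩ := h
      rw [cs.pathEnd_cons_of_eq hj hij, cs.pathLabels_cons_of_eq hj hij, wordProd_cons,
        wordProd_cons, mul_assoc, ← ih, ← hij]
      simp [mul_assoc]
    · rw [cs.pathEnd_cons_of_not h, cs.pathLabels_cons_of_not h, wordProd_cons, ← ih, mul_assoc]

-- A loop contributes its reflection e sᵢ e⁻¹ ∈ W_T to the inversions; a move contributes none,
-- since its e sᵢ e⁻¹ lies outside W_T. Hence the recorded word inherits distinctness and reversal
-- of inversions from `ω`.
open Classical in
theorem leftInvSeq_pathLabels {e : W} (he : e ∈ cs.minimalReps T) (ω : List B) :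
    cs.leftInvSeq (cs.pathLabels T ω e) =
      ((cs.leftInvSeq ω).map (MulAut.conj e)).filter (· ∈ cs.parabolic T) := by
  induction ω generalizing e with
  | nil => simp [pathLabels]
  | cons i ω ih =>
    by_cases h : ∃ j ∈ T, e * cs.simple i * e⁻¹ = cs.simple j
    · obtain ⟨j, hj, hij⟩ := h
      have hjT := cs.simple_mem_parabolic hj
      rw [cs.pathLabels_cons_of_eq hj hij, leftInvSeq, ih he, leftInvSeq, List.map_cons,
        MulAut.conj_apply, hij, List.filter_cons_of_pos (by simpa using hjT), List.cons_inj_right,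
        List.map_map, List.filter_map, List.filter_map, List.map_map]
      have hf : ⇑(MulAut.conj (cs.simple j)) ∘ ⇑(MulAut.conj e) =
          ⇑(MulAut.conj e) ∘ ⇑(MulAut.conj (cs.simple i)) := by
        ext t
        simp [← hij, mul_assoc]
      rw [hf, ← hf]
      congr 2
      ext1 t
      exact decide_eq_decide.2
        (by simp [Subgroup.mul_mem_cancel_left _ hjT, Subgroup.mul_mem_cancel_right _ hjT])
    · have hnot : e * cs.simple i * e⁻¹ ∉ cs.parabolic T :=
        fun h' => h (cs.exists_eq_simple_of_mem_parabolic he h')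
      rw [cs.pathLabels_cons_of_not h, ih (cs.mul_simple_mem_minimalReps_of_not he h), leftInvSeq,
        List.map_cons, MulAut.conj_apply, List.filter_cons_of_neg (by simpa using hnot),
        List.map_map, map_mul]
      rfl

/-- A move replaces e by e sᵢ, which conjugates the reflections e s_z e⁻¹ by e sᵢ e⁻¹ ∈ `H`; so the
hypothesis on e persists along the path. -/
theorem simple_mem_of_mem_pathLabels {H : Subgroup W} {Z : Set B} {ω : List B}
    (hω : ∀ z ∈ ω, z ∈ Z) {e : W} (hH : ∀ z ∈ Z, e * cs.simple z * e⁻¹ ∈ H) {z : B}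
    (hz : z ∈ cs.pathLabels T ω e) : cs.simple z ∈ H := by
  induction ω generalizing e with
  | nil => simp [pathLabels] at hz
  | cons i ω ih =>
    have hi : i ∈ Z := hω i (by simp)
    have hω' : ∀ z ∈ ω, z ∈ Z := fun z hz => hω z (List.mem_cons_of_mem _ hz)
    by_cases h : ∃ j ∈ T, e * cs.simple i * e⁻¹ = cs.simple j
    · obtain ⟨j, hj, hij⟩ := h
      rw [cs.pathLabels_cons_of_eq hj hij, List.mem_cons] at hz
      obtain rfl | hz := hz
      · rw [← hij]
        exact hH i hi
      · exact ih hω' hH hz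
    · rw [cs.pathLabels_cons_of_not h] at hz
      refine ih hω' (fun z hz => ?_) hz
      have := mul_mem (mul_mem (hH i hi) (hH z hz)) (inv_mem (hH i hi))
      simpa [mul_assoc] using this

/-! ### The action on pairs of a group element and a coset -/

section Action

variable {K : Type v} [Group K] (κ : B → K)

/-- Both ends are minimal representatives of the same coset of W_T. -/
theorem pathEnd_braid {e : W} (he : e ∈ cs.minimalReps T) (x y : B) :
    cs.pathEnd T (alternatingList x y (M x y)) e = cs.pathEnd T (alternatingList y x (M x y)) e := by
  have h1 := cs.mul_wordProd_eq (T := T) (alternatingList x y (M x y)) e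
  have h2 := cs.mul_wordProd_eq (T := T) (alternatingList y x (M x y)) e
  rw [wordProd_alternatingList_comm, h2, ← inv_mul_eq_iff_eq_mul, ← mul_assoc] at h1
  refine cs.eq_of_mem_minimalReps (cs.pathEnd_mem_minimalReps he _)
    (cs.pathEnd_mem_minimalReps he _) (mul_mem (inv_mem ?_) ?_) h1.symm <;>
  exact cs.wordProd_mem_parabolic fun i => cs.mem_of_mem_pathLabels

theorem prod_pathLabels_braid
    (hκ : ∀ p ∈ T, ∀ q ∈ T, p ≠ q → M p q ≠ 0 →
      alternatingProd (κ p) (κ q) (M p q) = alternatingProd (κ q) (κ p) (M p q))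
    {e : W} (he : e ∈ cs.minimalReps T) (x y : B) :
    ((cs.pathLabels T (alternatingList x y (M x y)) e).map κ).prod =
      ((cs.pathLabels T (alternatingList y x (M x y)) e).map κ).prod := by
  classical
  obtain ⟨H, hx, hy, hH⟩ := cs.exists_subgroup_not_three_simple e x y
  have hZ : ∀ z ∈ ({x, y} : Set B), e * cs.simple z * e⁻¹ ∈ H := by
    rintro z (rfl | rfl)
    exacts [hx, hy]
  refine cs.prod_map_eq_of_leftInvSeq_eq_reverse κ hκ (S := {z | cs.simple z ∈ H})
    (fun z => cs.mem_of_mem_pathLabels)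
    (fun z => cs.simple_mem_of_mem_pathLabels (fun z hz => mem_alternatingList hz) hZ)
    (fun z => cs.simple_mem_of_mem_pathLabels (fun z hz => (mem_alternatingList hz).symm) hZ)
    (fun p hp q hq r hr => hH p q r hp hq hr) ?_ ?_
  · rw [cs.leftInvSeq_pathLabels he]
    exact ((cs.nodup_leftInvSeq_alternatingList x y).map (MulAut.conj e).injective).filter _
  · rw [cs.leftInvSeq_pathLabels he, cs.leftInvSeq_pathLabels he, leftInvSeq_alternatingList_comm,
      List.map_reverse, List.filter_reverse]

variable (T)

open Classical in
/-- The right action of the generator `i` on pairs of an element of `K` and a coset of `W_T`. -/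
noncomputable def cosetStep (i : B) (p : K × cs.minimalReps T) : K × cs.minimalReps T :=
  if h : ∃ j ∈ T, (p.2 : W) * cs.simple i * (p.2 : W)⁻¹ = cs.simple j then
    (p.1 * κ h.choose, p.2)
  else (p.1, ⟨p.2 * cs.simple i, cs.mul_simple_mem_minimalReps_of_not p.2.2 h⟩)

variable {T}

theorem cosetStep_of_eq {i j : B} {p : K × cs.minimalReps T} (hj : j ∈ T)
    (h : (p.2 : W) * cs.simple i * (p.2 : W)⁻¹ = cs.simple j) :
    cs.cosetStep T κ i p = (p.1 * κ j, p.2) := by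
  have h' : ∃ j ∈ T, (p.2 : W) * cs.simple i * (p.2 : W)⁻¹ = cs.simple j := ⟨j, hj, h⟩
  rw [cosetStep, dif_pos h', cs.choose_eq h h']

theorem cosetStep_of_not {i : B} {p : K × cs.minimalReps T}
    (h : ¬ ∃ j ∈ T, (p.2 : W) * cs.simple i * (p.2 : W)⁻¹ = cs.simple j) :
    cs.cosetStep T κ i p =
      (p.1, ⟨p.2 * cs.simple i, cs.mul_simple_mem_minimalReps_of_not p.2.2 h⟩) := by
  rw [cosetStep, dif_neg h]

theorem cosetStep_leftInverse {κ κ' : B → K} (h : ∀ i, κ i * κ' i = 1) (i : B) :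
    Function.LeftInverse (cs.cosetStep T κ' i) (cs.cosetStep T κ i) := by
  intro p
  by_cases h' : ∃ j ∈ T, (p.2 : W) * cs.simple i * (p.2 : W)⁻¹ = cs.simple j
  · obtain ⟨j, hj, hij⟩ := h'
    rw [cs.cosetStep_of_eq κ hj hij, cs.cosetStep_of_eq κ' (p := (p.1 * κ j, p.2)) hj hij,
      mul_assoc, h, mul_one]
  · rw [cs.cosetStep_of_not κ h', cs.cosetStep_of_not]
    · simp
    · simpa [mul_assoc] using h'

variable (T) in
/-- `CoxeterSystem.cosetStep` as a permutation. -/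
noncomputable def cosetPerm (i : B) : Equiv.Perm (K × cs.minimalReps T) where
  toFun := cs.cosetStep T κ i
  invFun := cs.cosetStep T (fun j => (κ j)⁻¹) i
  left_inv := cs.cosetStep_leftInverse (by simp) i
  right_inv := cs.cosetStep_leftInverse (by simp) i

theorem foldl_cosetStep (ω : List B) (p : K × cs.minimalReps T) :
    ω.foldl (fun p i => cs.cosetStep T κ i p) p =
      (p.1 * ((cs.pathLabels T ω p.2).map κ).prod,
        ⟨cs.pathEnd T ω p.2, cs.pathEnd_mem_minimalReps p.2.2 ω⟩) := by
  induction ω generalizing p with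
  | nil => simp [pathLabels, pathEnd]
  | cons i ω ih =>
    rw [List.foldl_cons, ih]
    by_cases h : ∃ j ∈ T, (p.2 : W) * cs.simple i * (p.2 : W)⁻¹ = cs.simple j
    · obtain ⟨j, hj, hij⟩ := h
      simp [cs.cosetStep_of_eq κ hj hij, cs.pathLabels_cons_of_eq hj hij,
        cs.pathEnd_cons_of_eq hj hij, mul_assoc]
    · simp [cs.cosetStep_of_not κ h, cs.pathLabels_cons_of_not h, cs.pathEnd_cons_of_not h]

open MulOpposite in
theorem unop_alternatingProd_apply (x y : B) (n : ℕ) (p : K × cs.minimalReps T) :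
    unop (alternatingProd (op (cs.cosetPerm T κ x)) (op (cs.cosetPerm T κ y)) n) p =
      (alternatingList x y n).foldl (fun p i => cs.cosetStep T κ i p) p := by
  induction n generalizing x y p with
  | zero => rfl
  | succ n ih =>
    rw [alternatingProd, unop_mul, Equiv.Perm.mul_apply, ih]
    rfl

open MulOpposite in
theorem cosetPerm_braid
    (hκ : ∀ p ∈ T, ∀ q ∈ T, p ≠ q → M p q ≠ 0 →
      alternatingProd (κ p) (κ q) (M p q) = alternatingProd (κ q) (κ p) (M p q)) (x y : B) :
    alternatingProd (op (cs.cosetPerm T κ x)) (op (cs.cosetPerm T κ y)) (M x y) =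
      alternatingProd (op (cs.cosetPerm T κ y)) (op (cs.cosetPerm T κ x)) (M x y) := by
  apply unop_injective
  ext1 p
  rw [unop_alternatingProd_apply, unop_alternatingProd_apply, foldl_cosetStep, foldl_cosetStep,
    cs.prod_pathLabels_braid κ hκ p.2.2]
  simp only [cs.pathEnd_braid p.2.2 x y]

theorem cosetPerm_apply_one {i : B} (hi : i ∈ T) (g : K) :
    cs.cosetPerm T κ i (g, ⟨1, cs.one_mem_minimalReps⟩) =
      (g * κ i, ⟨1, cs.one_mem_minimalReps⟩) :=
  cs.cosetStep_of_eq κ hi (by simp)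

end Action

end CoxeterSystem

/-! ### Artin groups of full subgraphs embed -/

namespace LabelledGraph

variable {V : Type u} {V' : Type v}

theorem alternatingProd_of_eq (Γ : LabelledGraph V) {x y : V} (h : Γ.graph.Adj x y) :
    alternatingProd (PresentedGroup.of (rels := Γ.artinRelators) x) (PresentedGroup.of y)
        (Γ.label.get x y h) =
      alternatingProd (PresentedGroup.of y) (PresentedGroup.of x) (Γ.label.get x y h) := by
  have key : PresentedGroup.mk Γ.artinRelators _ = 1 :=
    PresentedGroup.one_of_mem ⟨x, y, h, rfl⟩
  rw [map_mul, map_inv, map_alternatingProd, map_alternatingProd, mul_inv_eq_one] at key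
  exact key

/-- A family of elements satisfying the braid relations defines a homomorphism of the Artin
group. -/
def artinLift (Γ : LabelledGraph V) {G : Type v} [Group G] (f : V → G)
    (hf : ∀ (x y : V) (h : Γ.graph.Adj x y), alternatingProd (f x) (f y) (Γ.label.get x y h) =
      alternatingProd (f y) (f x) (Γ.label.get x y h)) : Γ.ArtinGroup →* G :=
  PresentedGroup.toGroup (f := f) (by
    rintro r ⟨x, y, h, rfl⟩
    rw [map_mul, map_inv, map_alternatingProd, map_alternatingProd, mul_inv_eq_one]
    simpa only [FreeGroup.lift_apply_of] using hf x y h)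

theorem artinLift_of (Γ : LabelledGraph V) {G : Type v} [Group G] (f : V → G)
    (hf : ∀ (x y : V) (h : Γ.graph.Adj x y), alternatingProd (f x) (f y) (Γ.label.get x y h) =
      alternatingProd (f y) (f x) (Γ.label.get x y h)) (x : V) :
    Γ.artinLift f hf (PresentedGroup.of x) = f x :=
  PresentedGroup.toGroup.of _

open Classical in
/-- The Coxeter matrix of a labelled graph. -/
noncomputable def coxeterMatrix (Γ : LabelledGraph V) : CoxeterMatrix V where
  M := Matrix.of fun x y =>
    if x = y then 1 else if h : Γ.graph.Adj x y then Γ.label.get x y h else 0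
  isSymm := by
    ext x y
    simp only [Matrix.transpose_apply, Matrix.of_apply, eq_comm (a := x), Γ.graph.adj_comm x y]
    congr 1
    split_ifs with h
    · exact Γ.label.get_comm _ _ _
    · rfl
  diagonal x := by simp
  off_diagonal x y hxy := by
    simp only [Matrix.of_apply, if_neg hxy]
    split_ifs with h
    · have := Γ.two_le_label ⟨s(x, y), h⟩
      rw [SimpleGraph.EdgeLabeling.get_eq]
      omega
    · simp

theorem coxeterMatrix_of_adj (Γ : LabelledGraph V) {x y : V} (h : Γ.graph.Adj x y) :
    Γ.coxeterMatrix x y = Γ.label.get x y h := by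
  simp [coxeterMatrix, h, h.ne]

theorem adj_of_coxeterMatrix_ne_zero (Γ : LabelledGraph V) {x y : V} (hxy : x ≠ y)
    (h : Γ.coxeterMatrix x y ≠ 0) : Γ.graph.Adj x y := by
  by_contra h'
  simp [coxeterMatrix, h', hxy] at h

/-- The Artin group of a full labelled subgraph is a subgroup of the Artin group. -/
theorem Inclusion.artinMap_injective {Γ₁ : LabelledGraph V} {Γ₂ : LabelledGraph V'}
    (i : Inclusion Γ₁ Γ₂)
    (hfull : ∀ x y, Γ₂.graph.Adj (i.toFun x) (i.toFun y) → Γ₁.graph.Adj x y) :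
    Function.Injective i.artinMap := by
  let cs := Γ₂.coxeterMatrix.toCoxeterSystem
  let T : Set V' := Set.range i.toFun
  -- The value 1 off the image is immaterial: only letters in `T` are ever recorded.
  let κ : V' → Γ₁.ArtinGroup := Function.extend i.toFun PresentedGroup.of 1
  have hκ : ∀ x, κ (i.toFun x) = PresentedGroup.of x := i.injective.extend_apply _ _
  have hbraid : ∀ p ∈ T, ∀ q ∈ T, p ≠ q → Γ₂.coxeterMatrix p q ≠ 0 →
      alternatingProd (κ p) (κ q) (Γ₂.coxeterMatrix p q) =
        alternatingProd (κ q) (κ p) (Γ₂.coxeterMatrix p q) := by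
    rintro _ ⟨x, rfl⟩ _ ⟨y, rfl⟩ hne h0
    have h₂ := Γ₂.adj_of_coxeterMatrix_ne_zero hne h0
    have h₁ := hfull x y h₂
    rw [Γ₂.coxeterMatrix_of_adj h₂, i.map_label h₁, hκ, hκ, Γ₁.alternatingProd_of_eq]
  let Φ : Γ₂.ArtinGroup →* (Equiv.Perm (Γ₁.ArtinGroup × cs.minimalReps T))ᵐᵒᵖ :=
    Γ₂.artinLift (fun y => MulOpposite.op (cs.cosetPerm T κ y)) fun x y h => by
      rw [← Γ₂.coxeterMatrix_of_adj h]
      exact cs.cosetPerm_braid κ hbraid x y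
  have key : ∀ a g : Γ₁.ArtinGroup,
      (Φ (i.artinMap a)).unop (g, ⟨1, cs.one_mem_minimalReps⟩) =
        (g * a, ⟨1, cs.one_mem_minimalReps⟩) := by
    intro a
    have ha : a ∈ Subgroup.closure (Set.range (PresentedGroup.of (rels := Γ₁.artinRelators))) := by
      simp [PresentedGroup.closure_range_of]
    induction ha using Subgroup.closure_induction with
    | mem x hx =>
      obtain ⟨x, rfl⟩ := hx
      intro g
      rw [i.artinMap_of, artinLift_of, MulOpposite.unop_op,
        cs.cosetPerm_apply_one κ (Set.mem_range_self x), hκ]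
    | one => simp
    | mul x y _ _ hx hy =>
      intro g
      rw [map_mul, map_mul, MulOpposite.unop_mul, Equiv.Perm.mul_apply, hx, hy, mul_assoc]
    | inv x _ hx =>
      intro g
      rw [map_inv, map_inv, MulOpposite.unop_inv, Equiv.Perm.inv_eq_iff_eq, hx,
        inv_mul_cancel_right]
  rw [injective_iff_map_eq_one]
  intro a ha
  have := key a 1
  rw [ha, map_one, one_mul] at this
  exact (congrArg Prod.fst this).symm

end LabelledGraph

/-! ### Orbit representatives -/

namespace Subgroup

/-- A representative of the orbit of `y` under the subgroup `S`. -/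
noncomputable def orbitRep {G Q : Type*} [Group G] [MulAction G Q] (S : Subgroup G) (y : Q) : Q :=
  Quotient.out (Quotient.mk (MulAction.orbitRel S Q) y)

section OrbitRep

variable {G Q : Type*} [Group G] [MulAction G Q] (S : Subgroup G)

theorem exists_smul_orbitRep (y : Q) : ∃ s ∈ S, s • S.orbitRep y = y := by
  have h : (MulAction.orbitRel S Q) (S.orbitRep y) y := Quotient.mk_out y
  obtain ⟨s, hs⟩ := (MulAction.orbitRel S Q).symm h
  exact ⟨s, s.2, hs⟩

theorem orbitRep_smul {s : G} (hs : s ∈ S) (y : Q) : S.orbitRep (s • y) = S.orbitRep y := by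
  refine congrArg Quotient.out (Quotient.sound ?_)
  exact ⟨⟨s, hs⟩, rfl⟩

theorem orbitRep_orbitRep_of_le {C : Subgroup G} (h : C ≤ S) (y : Q) :
    S.orbitRep (C.orbitRep y) = S.orbitRep y := by
  obtain ⟨c, hc, hy⟩ := C.exists_smul_orbitRep y
  conv_rhs => rw [← hy, S.orbitRep_smul (h hc)]

end OrbitRep

/-! ### Cocycles of an amalgamated product acting on a set -/

section Cocycle

variable {G Q : Type u} [Group G] [MulAction G Q] {ι : Type} (C : Subgroup G) (S : ι → Subgroup G)

/-- The base point of the component of `y`: a representative of its `C`-orbit, or, among the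
chosen representatives of `C`-orbits, one in the `S i`-orbit of `y`. -/
noncomputable def treeBase : Option ι → Q → Q
  | none, y => C.orbitRep y
  | some i, y => C.orbitRep ((S i).orbitRep y)

/-- Whether there is an edge from the base point to `y` in the graph of generators. -/
def IsTreeEdge : Option ι → Q → Prop
  | none, y => C.orbitRep y ≠ y
  | some i, y => C.orbitRep y = y ∧ C.orbitRep ((S i).orbitRep y) ≠ y

/-- The subgroup moving the base point to `y`. -/
def treeGroup : Option ι → Subgroup G
  | none => C
  | some i => S i

variable {C S}

theorem treeBase_some_smul (i : ι) {s : G} (hs : s ∈ S i) (y : Q) :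
    treeBase C S (some i) (s • y) = treeBase C S (some i) y := by
  simp [treeBase, orbitRep_smul _ hs]

theorem exists_smul_treeBase (hC : ∀ i, C ≤ S i) (k : Option ι) (y : Q) :
    ∃ g ∈ treeGroup C S k, g • treeBase C S k y = y := by
  cases k with
  | none => exact C.exists_smul_orbitRep y
  | some i =>
    obtain ⟨s, hs, hy⟩ := (S i).exists_smul_orbitRep y
    obtain ⟨c, hc, hz⟩ := C.exists_smul_orbitRep ((S i).orbitRep y)
    exact ⟨s * c, mul_mem hs (hC i hc), by rw [treeBase, mul_smul, hz, hy]⟩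

theorem orbitRep_orbitRep (y : Q) : C.orbitRep (C.orbitRep y) = C.orbitRep y :=
  C.orbitRep_orbitRep_of_le le_rfl y

theorem treeBase_some_orbitRep (hC : ∀ i, C ≤ S i) (i : ι) (y : Q) :
    treeBase C S (some i) (C.orbitRep y) = treeBase C S (some i) y := by
  simp [treeBase, orbitRep_orbitRep_of_le _ (hC i)]

theorem treeBase_some_treeBase_some (hC : ∀ i, C ≤ S i) (i : ι) (y : Q) :
    treeBase C S (some i) (treeBase C S (some i) y) = treeBase C S (some i) y := by
  simp [treeBase, orbitRep_orbitRep_of_le _ (hC i), orbitRep_orbitRep_of_le _ le_rfl]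

/-- The potential on `Q` obtained by adding up the labels on the path to `y` in the tree. -/
noncomputable def potential {X : Type*} [Group X] (C : Subgroup G) (l : Option ι → Q → X) (i : ι) (y : Q) : X :=
  l none y * l (some i) (C.orbitRep y)

/-- Base points carry no tree edge of their own kind, so their labels are trivial and only the label
of the edge itself survives. -/
theorem potential_mul_inv_potential {X : Type*} [Group X] {l : Option ι → Q → X}
    (hl : ∀ k y, ¬ IsTreeEdge C S k y → l k y = 1) (hC : ∀ i, C ≤ S i) (i : ι) {k : Option ι}
    (hk : k = none ∨ k = some i) {y : Q} (hy : IsTreeEdge C S k y) :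
    potential C l i y * (potential C l i (treeBase C S k y))⁻¹ = l k y := by
  have h0 : ∀ z, C.orbitRep z = z → l none z = 1 := fun z hz => hl _ _ fun h => h hz
  obtain rfl | rfl := hk
  · simp only [potential, treeBase, orbitRep_orbitRep, h0, one_mul, mul_inv_cancel_right]
  · have h1 : C.orbitRep (treeBase C S (some i) y) = treeBase C S (some i) y :=
      C.orbitRep_orbitRep _
    have h2 : l (some i) (treeBase C S (some i) y) = 1 :=
      hl _ _ fun h => h.2 (treeBase_some_treeBase_some hC i y)
    rw [potential, potential, h1, h2, h0 _ h1, h0 _ hy.1, hy.1]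
    simp

open SemidirectProduct in
/-- Cocycles on an amalgamated product whose factors act freely correspond to labellings of
the edges of the tree. -/
theorem existsUnique_cocycle [Nonempty ι] (hC : ∀ i, C ≤ S i) (hgen : ⨆ i, S i = ⊤)
    (hlift : ∀ {Y : Type u} [Group Y] (f : ∀ i, S i →* Y),
      (∀ i j c (hc : c ∈ C), f i ⟨c, hC i hc⟩ = f j ⟨c, hC j hc⟩) →
        ∃ F : G →* Y, ∀ i (s : S i), F s = f i s)
    (hfree : ∀ i, ∀ s ∈ S i, ∀ y : Q, s • y = y → s = 1)
    {g : Option ι → Q → G} (hg : ∀ k y, g k y ∈ treeGroup C S k)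
    (hgy : ∀ k y, g k y • treeBase C S k y = y) {X : Type u} [Group X] {l : Option ι → Q → X}
    (hl : ∀ k y, ¬ IsTreeEdge C S k y → l k y = 1) :
    ∃! Ψ : G →* (Q → X) ⋊[mulAutArrow] G,
      (∀ a, (Ψ a).right = a) ∧ ∀ k y, IsTreeEdge C S k y → (Ψ (g k y)).left y = l k y := by
  have hmem : ∀ i k, k = none ∨ k = some i → ∀ y, g k y ∈ S i := by
    rintro i k (rfl | rfl) y
    exacts [hC i (hg none y), hg (some i) y]
  have hginv : ∀ k y, (g k y)⁻¹ • y = treeBase C S k y := fun k y => by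
    rw [inv_smul_eq_iff, hgy]
  have hCinv : ∀ {c : G}, c ∈ C → ∀ y : Q, C.orbitRep (c⁻¹ • y) = C.orbitRep y := fun hc y =>
    C.orbitRep_smul (inv_mem hc) y
  -- Homomorphisms to the semidirect product over the identity of `G` are cocycles. On each factor
  -- the cocycle is the coboundary of that factor's potential.
  let f : ∀ i, S i →* (Q → X) ⋊[mulAutArrow] G := fun i =>
    (MulAut.conj (inl (potential C l i))).toMonoidHom.comp (inr.comp (S i).subtype)
  have hfl : ∀ i s y, (f i s).left y =
      potential C l i y * (potential C l i ((s : G)⁻¹ • y))⁻¹ := by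
    intro i s y
    change (inl (potential C l i) * inr (s : G) * (inl (potential C l i))⁻¹ :
      (Q → X) ⋊[mulAutArrow] G).left y = _
    rw [← map_inv, mul_left, mul_left]
    simp only [left_inl, left_inr, right_inl, right_inr, mul_right, map_one, one_mul, mul_one]
    rfl
  have hfr : ∀ i s, (f i s).right = s := by
    intro i s
    simp [f]
  -- The part of the potential depending on i is constant on `C`-orbits, so it cancels for elements
  -- of `C`.
  obtain ⟨Ψ, hΨ⟩ := hlift f (by
    intro i j c hc
    ext y
    · rw [hfl, hfl]
      simp only [potential, hCinv hc]
      group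
    · rw [hfr, hfr])
  refine ⟨Ψ, ⟨?_, ?_⟩, ?_⟩
  · suffices rightHom.comp Ψ = MonoidHom.id G from fun a => DFunLike.congr_fun this a
    have htop : ⨆ i, S i ≤ (rightHom.comp Ψ).eqLocus (MonoidHom.id G) :=
      iSup_le fun i s hs => by
        change (Ψ s).right = s
        rw [hΨ i ⟨s, hs⟩, hfr]
    rw [hgen] at htop
    exact MonoidHom.eq_of_eqOn_top htop
  · intro k y hy
    obtain ⟨i, hi⟩ : ∃ i, k = none ∨ k = some i := by
      cases k with
      | none => exact ⟨Classical.arbitrary ι, Or.inl rfl⟩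
      | some i => exact ⟨i, Or.inr rfl⟩
    rw [hΨ i ⟨g k y, hmem i k hi y⟩, hfl, hginv, potential_mul_inv_potential hl hC i hi hy]
  · rintro Ψ' ⟨hr, hE⟩
    have hmul : ∀ a b y, (Ψ' (a * b)).left y = (Ψ' a).left y * (Ψ' b).left (a⁻¹ • y) := by
      intro a b y
      rw [map_mul, mul_left, hr]
      rfl
    have hval : ∀ k y, (k = none ∨ C.orbitRep y = y) → (Ψ' (g k y)).left y = l k y := by
      intro k y hky
      by_cases hedge : IsTreeEdge C S k y
      · exact hE k y hedge
      have hbase : treeBase C S k y = y := by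
        by_contra hne
        apply hedge
        cases k with
        | none => exact hne
        | some i => exact ⟨by simpa using hky, hne⟩
      obtain ⟨i, hi⟩ : ∃ i, k = none ∨ k = some i := by
        cases k with
        | none => exact ⟨Classical.arbitrary ι, Or.inl rfl⟩
        | some i => exact ⟨i, Or.inr rfl⟩
      have h1 : g k y = 1 := by
        refine hfree i _ (hmem i k hi y) y ?_
        conv_lhs => rw [← hbase]
        rw [hbase]
        conv_rhs => rw [← hgy k y, hbase]
      rw [hl k y hedge, h1, map_one]
      rfl
    have hpath : ∀ i y, (Ψ' (g none y * g (some i) (C.orbitRep y))).left y =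
        potential C l i y := by
      intro i y
      rw [hmul, hval none y (Or.inl rfl), hginv, treeBase,
        hval (some i) _ (Or.inr (C.orbitRep_orbitRep y)), potential]
    have hpathy : ∀ i y, (g none y * g (some i) (C.orbitRep y)) • treeBase C S (some i) y = y := by
      intro i y
      rw [mul_smul, ← treeBase_some_orbitRep hC, hgy]
      exact hgy none y
    have hS : ∀ i, ∀ s ∈ S i, Ψ' s = Ψ s := by
      intro i s hs
      rw [hΨ i ⟨s, hs⟩]
      ext y
      · rw [hfl]
        have hmem' : ∀ y, g none y * g (some i) (C.orbitRep y) ∈ S i := fun y =>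
          mul_mem (hmem i _ (Or.inl rfl) _) (hmem i _ (Or.inr rfl) _)
        -- Both sides lie in `S i` and carry the common base point to y, so they agree by freeness.
        -- The values of `Ψ'` on `S i` are thereby determined by those on tree paths.
        have heq : s * (g none (s⁻¹ • y) * g (some i) (C.orbitRep (s⁻¹ • y))) =
            g none y * g (some i) (C.orbitRep y) := by
          rw [← inv_mul_eq_one]
          refine hfree i _ (mul_mem (inv_mem (mul_mem hs (hmem' _))) (hmem' _))
            (treeBase C S (some i) y) ?_
          rw [mul_smul, hpathy, inv_smul_eq_iff, mul_smul,
            ← treeBase_some_smul i (inv_mem hs) y, hpathy, smul_inv_smul]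
        have := hmul s (g none (s⁻¹ • y) * g (some i) (C.orbitRep (s⁻¹ • y))) y
        rw [heq, hpath, hpath] at this
        rw [this, mul_inv_cancel_right]
      · rw [hr, hfr]
    have htop : ⨆ i, S i ≤ Ψ'.eqLocus Ψ := iSup_le hS
    rw [hgen] at htop
    exact MonoidHom.eq_of_eqOn_top htop

open CategoryTheory ActionCategory in
/-- The action groupoid of an amalgamated product whose factors act freely is free. -/
@[reducible]
noncomputable def isFreeGroupoidActionCategory [Nonempty ι] (hC : ∀ i, C ≤ S i)
    (hgen : ⨆ i, S i = ⊤)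
    (hlift : ∀ {Y : Type u} [Group Y] (f : ∀ i, S i →* Y),
      (∀ i j c (hc : c ∈ C), f i ⟨c, hC i hc⟩ = f j ⟨c, hC j hc⟩) →
        ∃ F : G →* Y, ∀ i (s : S i), F s = f i s)
    (hfree : ∀ i, ∀ s ∈ S i, ∀ y : Q, s • y = y → s = 1) :
    IsFreeGroupoid (ActionCategory G Q) where
  quiverGenerators := ⟨fun a b => ULift.{u} {k : Option ι //
    ActionCategory.back a = treeBase C S k (ActionCategory.back b) ∧
      IsTreeEdge C S k (ActionCategory.back b)}⟩
  of := fun {a b} e =>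
    let g : G := (exists_smul_treeBase hC e.down.1 (ActionCategory.back b)).choose
    have h : g • ActionCategory.back a = ActionCategory.back b := by
      rw [e.down.2.1]
      exact (exists_smul_treeBase hC e.down.1 (ActionCategory.back b)).choose_spec.2
    ⟨g, h⟩
  unique_lift := by
    classical
    intro X _ f
    let l : Option ι → Q → X := fun k y =>
      if h : IsTreeEdge C S k y then
        @f (objEquiv G Q (treeBase C S k y)) (objEquiv G Q y) ⟨⟨k, rfl, h⟩⟩
      else 1
    obtain ⟨Ψ, ⟨hr, hl⟩, huniq⟩ := existsUnique_cocycle (C := C) (S := S) hC hgen hlift hfree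
      (fun k y => (exists_smul_treeBase hC k y).choose_spec.1)
      (fun k y => (exists_smul_treeBase hC k y).choose_spec.2) (l := l)
      (fun k y h => dif_neg h)
    have key : ∀ (k : Option ι) (x y : Q) (hx : x = treeBase C S k y) (h : IsTreeEdge C S k y),
        l k y = @f (objEquiv G Q x) (objEquiv G Q y) ⟨⟨k, hx, h⟩⟩ := by
      rintro k x y rfl h
      exact dif_pos h
    refine ⟨uncurry Ψ hr, ?_, ?_⟩
    · intro a b e
      exact (hl e.down.1 (ActionCategory.back b) e.down.2.2).trans
        (key e.down.1 (ActionCategory.back a) (ActionCategory.back b) e.down.2.1 e.down.2.2)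
    · intro E hE
      have hval : ∀ (a b : ActionCategory G Q) (p : a ⟶ b),
          E.map p = (curry E p.val).left b.back :=
        fun a b p => ActionCategory.cases
          (P := fun a b p => E.map p = (curry E p.val).left b.back) (fun _ _ => rfl) p
      have : curry E = Ψ := by
        refine huniq _ ⟨fun a => rfl, fun k y h => ?_⟩
        exact (hval _ _ _).symm.trans ((hE (objEquiv G Q (treeBase C S k y)) (objEquiv G Q y)
          ⟨⟨k, rfl, h⟩⟩).trans (key k _ y rfl h).symm)
      refine Functor.hext (fun _ => rfl) fun a b p => heq_of_eq ?_
      refine (hval a b p).trans ?_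
      rw [this]
      rfl

/-- A normal subgroup of an amalgamated product which meets the factors trivially is free. -/
theorem isFreeGroup_of_amalgam [Nonempty ι] (hC : ∀ i, C ≤ S i) (hgen : ⨆ i, S i = ⊤)
    (hlift : ∀ {Y : Type u} [Group Y] (f : ∀ i, S i →* Y),
      (∀ i j c (hc : c ∈ C), f i ⟨c, hC i hc⟩ = f j ⟨c, hC j hc⟩) →
        ∃ F : G →* Y, ∀ i (s : S i), F s = f i s)
    (N : Subgroup G) [N.Normal] (hN : ∀ i, ∀ s ∈ S i, s ∈ N → s = 1) : IsFreeGroup N := by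
  -- As `N` is normal, the stabilizer of every coset is `N`, which meets each factor trivially.
  let _ := isFreeGroupoidActionCategory (Q := G ⧸ N) hC hgen hlift (by
    intro i s hs y hy
    induction y using QuotientGroup.induction_on with
    | H y =>
      refine hN i s hs ?_
      rw [MulAction.Quotient.smul_coe, QuotientGroup.eq, smul_eq_mul, mul_inv_rev] at hy
      have := Subgroup.Normal.conj_mem ‹N.Normal› _ hy y
      simpa [mul_assoc] using this)
  have hconn : CategoryTheory.IsConnected (CategoryTheory.ActionCategory G (G ⧸ N)) := inferInstance
  have h := @IsFreeGroupoid.endIsFreeOfConnectedFree _ _ hconn _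
    (CategoryTheory.ActionCategory.objEquiv G (G ⧸ N) ((1 : G) : G ⧸ N))
  exact @IsFreeGroup.ofMulEquiv _ _ h _ _
    (CategoryTheory.ActionCategory.endMulEquivSubgroup N)

end Cocycle

end Subgroup

/-! ### Inheritance of poly-freeness -/

section PolyFree

variable {G : Type u} {H : Type v} [Group G] [Group H]

/-- The range is a subgroup of a free group, hence free by Nielsen–Schreier. -/
theorem isFreeGroup_of_injective [IsFreeGroup H] (f : G →* H) (hf : Function.Injective f) :
    IsFreeGroup G :=
  ((IsFreeGroup.basis f.range).map (MonoidHom.ofInjective hf).symm).isFreeGroup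

theorem isFreeGroup_ker_of_injective {f : G →* H} (hf : Function.Injective f) :
    IsFreeGroup f.ker := by
  refine isFreeGroup_of_injective (1 : f.ker →* FreeGroup Empty) fun x y _ => ?_
  exact Subtype.ext (hf (x.2.trans y.2.symm))

theorem isFreeGroup_quotient_of_ker_eq [IsFreeGroup H] (f : G →* H) {K : Subgroup G}
    (hK : f.ker = K) : ∃ _ : K.Normal, IsFreeGroup (G ⧸ K) := by
  subst hK
  exact ⟨inferInstance,
    isFreeGroup_of_injective (QuotientGroup.kerLift f) (QuotientGroup.kerLift_injective f)⟩

/-- Pulling back a chain of subgroups along a homomorphism, and adding the trivial subgroup. -/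
def comapChain (f : G →* H) (C : ℕ → Subgroup H) : ℕ → Subgroup G
  | 0 => ⊥
  | i + 1 => (C i).comap f

theorem comapChain_step (f : G →* H) [IsFreeGroup f.ker] {C : ℕ → Subgroup H} (h0 : C 0 = ⊥)
    {n : ℕ} (h : ∀ i < n, C i ≤ C (i + 1) ∧ ∃ _ : ((C i).subgroupOf (C (i + 1))).Normal,
      IsFreeGroup (C (i + 1) ⧸ (C i).subgroupOf (C (i + 1)))) :
    ∀ i < n + 1, comapChain f C i ≤ comapChain f C (i + 1) ∧
      ∃ _ : ((comapChain f C i).subgroupOf (comapChain f C (i + 1))).Normal,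
        IsFreeGroup (comapChain f C (i + 1) ⧸
          (comapChain f C i).subgroupOf (comapChain f C (i + 1))) := by
  intro i hi
  cases i with
  | zero =>
    -- Indices are shifted by one: the first quotient is the kernel, and each later one embeds in a
    -- quotient of the original chain.
    have hker : comapChain f C 1 = f.ker := by
      rw [comapChain, h0, MonoidHom.comap_bot]
    refine ⟨bot_le, ?_⟩
    rw [hker, comapChain]
    exact isFreeGroup_quotient_of_ker_eq (MonoidHom.id f.ker) (by simp)
  | succ i =>
    obtain ⟨hle, hn, hfree⟩ := h i (by omega)
    refine ⟨Subgroup.comap_mono hle, ?_⟩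
    refine isFreeGroup_quotient_of_ker_eq
      ((QuotientGroup.mk' ((C i).subgroupOf (C (i + 1)))).comp (f.subgroupComap (C (i + 1)))) ?_
    ext x
    simp only [MonoidHom.mem_ker, MonoidHom.comp_apply, QuotientGroup.mk'_apply,
      QuotientGroup.eq_one_iff, Subgroup.mem_subgroupOf]
    rfl

theorem IsPolyFree.of_hom (f : G →* H) [IsFreeGroup f.ker] (h : IsPolyFree H) : IsPolyFree G := by
  obtain ⟨n, C, h0, hn, hstep⟩ := h
  exact ⟨n + 1, comapChain f C, rfl, by rw [comapChain, hn, Subgroup.comap_top],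
    comapChain_step f h0 hstep⟩

theorem IsNormallyPolyFree.of_hom (f : G →* H) [IsFreeGroup f.ker] (h : IsNormallyPolyFree H) :
    IsNormallyPolyFree G := by
  obtain ⟨n, C, h0, hn, hnorm, hstep⟩ := h
  refine ⟨n + 1, comapChain f C, rfl, by rw [comapChain, hn, Subgroup.comap_top], ?_,
    comapChain_step f h0 hstep⟩
  intro i hi
  cases i with
  | zero => exact Subgroup.normal_bot
  | succ i => exact (hnorm i (by omega)).comap f

theorem finiteIndex_comap (f : G →* H) (K : Subgroup H) [K.FiniteIndex] :
    (K.comap f).FiniteIndex := by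
  refine ⟨?_⟩
  rw [Subgroup.index_comap]
  exact fun h => K.index_ne_zero_of_finite (Subgroup.index_eq_zero_of_relIndex_eq_zero h)

theorem isFreeGroup_ker_subgroupComap (f : G →* H) [IsFreeGroup f.ker] (K : Subgroup H) :
    IsFreeGroup (f.subgroupComap K).ker :=
  isFreeGroup_of_injective
    (((K.comap f).subtype.comp (f.subgroupComap K).ker.subtype).codRestrict f.ker
      fun x => congrArg Subtype.val x.2)
    fun _ _ hxy => Subtype.ext (Subtype.ext (congrArg (fun z : f.ker => (z : G)) hxy))

theorem IsVirtuallyPolyFree.of_hom (f : G →* H) [IsFreeGroup f.ker] (h : IsVirtuallyPolyFree H) :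
    IsVirtuallyPolyFree G := by
  obtain ⟨K, hK, h⟩ := h
  have := isFreeGroup_ker_subgroupComap f K
  exact ⟨K.comap f, finiteIndex_comap f K, h.of_hom (f.subgroupComap K)⟩

theorem IsVirtuallyNormallyPolyFree.of_hom (f : G →* H) [IsFreeGroup f.ker]
    (h : IsVirtuallyNormallyPolyFree H) : IsVirtuallyNormallyPolyFree G := by
  obtain ⟨K, hK, h⟩ := h
  have := isFreeGroup_ker_subgroupComap f K
  exact ⟨K.comap f, finiteIndex_comap f K, h.of_hom (f.subgroupComap K)⟩

end PolyFree

/-! ### Adding edges and passing to subgraphs -/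

namespace LabelledGraph

variable {V : Type u} {W : Type v}

/-- The labelled graph on `V` whose edges are the pairs in `E` mapped by `g` to edges of `Γ`. -/
def restrict (Γ : LabelledGraph W) (g : V → W) (E : Set (Sym2 V)) : LabelledGraph V where
  graph :=
    { Adj := fun x y => Γ.graph.Adj (g x) (g y) ∧ s(x, y) ∈ E
      symm := ⟨fun x y h => ⟨h.1.symm, Sym2.eq_swap ▸ h.2⟩⟩
      loopless := ⟨fun x h => Γ.graph.irrefl h.1⟩ }
  label := SimpleGraph.EdgeLabeling.mk (fun x y h => Γ.label.get (g x) (g y) h.1)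
    fun _ _ _ => Γ.label.get_comm _ _ _
  two_le_label := by
    rintro ⟨e, he⟩
    induction e using Sym2.ind with
    | h x y => exact Γ.two_le_label _

/-- The inclusion of `Γ.restrict g E` in `Γ`. -/
def restrictInclusion (Γ : LabelledGraph W) {g : V → W} (hg : Function.Injective g)
    (E : Set (Sym2 V)) : Inclusion (Γ.restrict g E) Γ where
  toFun := g
  injective := hg
  map_adj h := h.1
  map_label _ := rfl

/-- The inclusion of `Γ.restrict g E` in `Γ.restrict g E'` for `E ⊆ E'`. -/
def restrictMono (Γ : LabelledGraph W) (g : V → W) {E E' : Set (Sym2 V)} (h : E ⊆ E') :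
    Inclusion (Γ.restrict g E) (Γ.restrict g E') where
  toFun := id
  injective := Function.injective_id
  map_adj hxy := ⟨hxy.1, h hxy.2⟩
  map_label _ := rfl

/-- The composition of two inclusions. -/
def Inclusion.comp {U : Type*} {Γ₀ : LabelledGraph U} {Γ₁ : LabelledGraph V} {Γ₂ : LabelledGraph W}
    (j : Inclusion Γ₁ Γ₂) (i : Inclusion Γ₀ Γ₁) : Inclusion Γ₀ Γ₂ where
  toFun := j.toFun ∘ i.toFun
  injective := j.injective.comp i.injective
  map_adj h := j.map_adj (i.map_adj h)
  map_label h := (j.map_label (i.map_adj h)).trans (i.map_label h)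

theorem Inclusion.artinMap_comp {U : Type*} {Γ₀ : LabelledGraph U} {Γ₁ : LabelledGraph V}
    {Γ₂ : LabelledGraph W} (j : Inclusion Γ₁ Γ₂) (i : Inclusion Γ₀ Γ₁) :
    (j.comp i).artinMap = j.artinMap.comp i.artinMap := by
  refine PresentedGroup.ext fun x => ?_
  rw [MonoidHom.comp_apply, artinMap_of, artinMap_of, artinMap_of]
  rfl

/-- The homomorphism of Artin groups induced by adding an edge has free kernel: the Artin group of
the smaller graph is the amalgamated product of the Artin groups of the two full subgraphs
obtained by removing one endpoint of the new edge, and both embed in the larger Artin group. -/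
theorem AddsEdge.isFreeGroup_ker {Γ₁ Γ₂ : LabelledGraph V} {a b : V} (h : AddsEdge Γ₁ Γ₂ a b) :
    IsFreeGroup h.inclusion.artinMap.ker := by
  classical
  let c : Bool → V := fun t => if t then a else b
  let j : ∀ t, Inclusion (Γ₁.restrict (Subtype.val : {x // x ≠ c t} → V) Set.univ) Γ₁ :=
    fun t => Γ₁.restrictInclusion Subtype.val_injective _
  let S : Bool → Subgroup Γ₁.ArtinGroup := fun t => (j t).artinMap.range
  let C : Subgroup Γ₁.ArtinGroup :=
    Subgroup.closure (PresentedGroup.of '' {x | ∀ t, x ≠ c t})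
  have hS : ∀ t x, x ≠ c t → PresentedGroup.of x ∈ S t := fun t x hx =>
    ⟨PresentedGroup.of ⟨x, hx⟩, (j t).artinMap_of _⟩
  have hC : ∀ t, C ≤ S t := by
    intro t
    rw [Subgroup.closure_le]
    rintro _ ⟨x, hx, rfl⟩
    exact hS t x (hx t)
  have hex : ∀ x, ∃ t, x ≠ c t := by
    intro x
    by_cases hx : x = a
    · exact ⟨false, by simpa [c, hx] using h.ne⟩
    · exact ⟨true, by simpa [c] using hx⟩
  -- The only pair that avoids neither endpoint is {a, b}, which is not an edge; so every defining
  -- relation lives in one factor.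
  have hedge : ∀ x y, Γ₁.graph.Adj x y → ∃ t, x ≠ c t ∧ y ≠ c t := by
    intro x y hxy
    by_contra! hcon
    have h1 := hcon true
    have h2 := hcon false
    simp only [c, if_true, Bool.false_eq_true, if_false] at h1 h2
    have h3 := h.not_adj
    have h4 := h.ne
    by_cases hx : x = a
    · subst hx
      exact h3 (h2 h4 ▸ hxy)
    · have hy := h1 hx
      subst hy
      by_cases hx' : x = b
      · subst hx'
        exact h3 hxy.symm
      · exact h4 (h2 hx')
  refine Subgroup.isFreeGroup_of_amalgam (C := C) (S := S) hC ?_ ?_ _ ?_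
  · rw [eq_top_iff, ← PresentedGroup.closure_range_of, Subgroup.closure_le]
    rintro _ ⟨x, rfl⟩
    obtain ⟨t, ht⟩ := hex x
    exact Subgroup.mem_iSup_of_mem t (hS t x ht)
  · intro Y _ f hf
    choose τ hτ using hex
    let F₀ : V → Y := fun x => f (τ x) ⟨PresentedGroup.of x, hS _ x (hτ x)⟩
    have hF₀ : ∀ t x (hx : x ≠ c t), F₀ x = f t ⟨PresentedGroup.of x, hS t x hx⟩ := by
      intro t x hx
      by_cases htx : τ x = t
      · subst htx
        rfl
      -- If x avoids both endpoints, its generator lies in `C`, where the given homomorphisms agree;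
      -- so the choice of factor does not matter.
      · refine hf (τ x) t _ (Subgroup.subset_closure ⟨x, fun t' => ?_, rfl⟩)
        obtain rfl | rfl : t' = τ x ∨ t' = t := by
          revert htx
          cases τ x <;> cases t <;> cases t' <;> simp
        exacts [hτ x, hx]
    have hbraid : ∀ (x y : V) (hxy : Γ₁.graph.Adj x y),
        alternatingProd (F₀ x) (F₀ y) (Γ₁.label.get x y hxy) =
          alternatingProd (F₀ y) (F₀ x) (Γ₁.label.get x y hxy) := by
      intro x y hxy
      obtain ⟨t, hx, hy⟩ := hedge x y hxy
      rw [hF₀ t x hx, hF₀ t y hy, ← map_alternatingProd, ← map_alternatingProd]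
      congr 1
      apply Subtype.val_injective
      have := Γ₁.alternatingProd_of_eq hxy
      rw [← Subgroup.coe_subtype, map_alternatingProd, map_alternatingProd]
      exact this
    refine ⟨Γ₁.artinLift F₀ hbraid, ?_⟩
    rintro t ⟨_, s, rfl⟩
    have : (Γ₁.artinLift F₀ hbraid).comp (j t).artinMap =
        (f t).comp (j t).artinMap.rangeRestrict := by
      refine PresentedGroup.ext fun x => ?_
      rw [MonoidHom.comp_apply, MonoidHom.comp_apply, Inclusion.artinMap_of, artinLift_of]
      refine (hF₀ t _ x.2).trans (congrArg (f t) ?_)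
      exact Subtype.ext ((j t).artinMap_of x).symm
    exact DFunLike.congr_fun this s
  · rintro t _ ⟨s, rfl⟩ hs
    -- Without one endpoint of the new edge, the subgraph is full in `Γ₂` as well.
    have hinj := (h.inclusion.comp (j t)).artinMap_injective (by
      rintro ⟨x, hx⟩ ⟨y, hy⟩ hxy
      refine ⟨((h.adj_iff x y).1 hxy).resolve_right fun heq => ?_, Set.mem_univ _⟩
      rw [Sym2.eq_iff] at heq
      cases t <;> simp only [c, if_true, Bool.false_eq_true, if_false] at hx hy <;> tauto)
    rw [Inclusion.artinMap_comp] at hinj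
    rw [(injective_iff_map_eq_one _).1 hinj s hs, map_one]

theorem addsEdge_restrict_insert (Γ : LabelledGraph W) (g : V → W) {E : Set (Sym2 V)} {a b : V}
    (hab : Γ.graph.Adj (g a) (g b)) (hE : s(a, b) ∉ E) :
    AddsEdge (Γ.restrict g E) (Γ.restrict g (insert s(a, b) E)) a b where
  ne h := Γ.graph.irrefl (h ▸ hab)
  not_adj h := hE h.2
  adj_iff x y := by
    constructor
    · rintro ⟨h1, h2 | h2⟩
      exacts [Or.inr h2, Or.inl ⟨h1, h2⟩]
    · rintro (h | h)
      · exact ⟨h.1, Or.inr h.2⟩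
      · refine ⟨?_, Or.inl h⟩
        rcases Sym2.eq_iff.1 h with ⟨rfl, rfl⟩ | ⟨rfl, rfl⟩
        exacts [hab, hab.symm]
  label_eq _ _ _ := rfl

/-- A property of groups inherited along homomorphisms with free kernel is inherited by the Artin
groups of labelled subgraphs with fewer edges. -/
theorem artinGroup_restrict_of_union {P : ∀ (G : Type u) [Group G], Prop}
    (hP : ∀ (G H : Type u) [Group G] [Group H] (f : G →* H), IsFreeGroup f.ker → P H → P G)
    (Γ : LabelledGraph W) (g : V → W) (E : Set (Sym2 V)) {F : Set (Sym2 V)} (hF : F.Finite)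
    (h : P (Γ.restrict g (E ∪ F)).ArtinGroup) : P (Γ.restrict g E).ArtinGroup := by
  induction F, hF using Set.Finite.induction_on with
  | empty => rwa [Set.union_empty] at h
  | @insert e F he hF ih =>
    apply ih
    rw [Set.union_insert] at h
    induction e using Sym2.ind with
    | h a b =>
      by_cases hab : Γ.graph.Adj (g a) (g b) ∧ s(a, b) ∉ E ∪ F
      · exact hP _ _ _ (Γ.addsEdge_restrict_insert g hab.1 hab.2).isFreeGroup_ker h
      -- The inserted pair is not an edge of `Γ` or is already present, so the graph does not change
      -- and the kernel is trivial.
      · refine hP _ _ (Γ.restrictMono g (Set.subset_insert _ _)).artinMap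
          (isFreeGroup_ker_of_injective (Inclusion.artinMap_injective _ ?_)) h
        rintro x y ⟨h1, h2 | h2⟩
        · refine ⟨h1, ?_⟩
          rw [not_and, not_not] at hab
          change s(x, y) = s(a, b) at h2
          rw [h2]
          apply hab
          rcases Sym2.eq_iff.1 h2 with ⟨rfl, rfl⟩ | ⟨rfl, rfl⟩
          exacts [h1, h1.symm]
        · exact ⟨h1, h2⟩

/-- A property of groups inherited along homomorphisms with free kernel is inherited by the Artin
groups of labelled subgraphs. -/
theorem Inclusion.artinGroup_of_restrict [Finite V] {P : ∀ (G : Type u) [Group G], Prop}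
    (hP : ∀ (G H : Type u) [Group G] [Group H] (f : G →* H), IsFreeGroup f.ker → P H → P G)
    {Γ₁ : LabelledGraph V} {Γ₂ : LabelledGraph W} (i : Inclusion Γ₁ Γ₂)
    (h : P (Γ₂.restrict i.toFun Set.univ).ArtinGroup) : P Γ₁.ArtinGroup := by
  let j : Inclusion Γ₁ (Γ₂.restrict i.toFun Γ₁.graph.edgeSet) :=
    { toFun := id
      injective := Function.injective_id
      map_adj := fun hxy => ⟨i.map_adj hxy, hxy⟩
      map_label := i.map_label }
  refine hP _ _ j.artinMap
    (isFreeGroup_ker_of_injective (j.artinMap_injective fun x y hxy => hxy.2)) ?_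
  refine artinGroup_restrict_of_union hP Γ₂ i.toFun _ (Set.toFinite Set.univ) ?_
  rwa [Set.union_univ]

theorem isFreeGroup_ker_restrictInclusion (Γ : LabelledGraph W) {g : V → W}
    (hg : Function.Injective g) :
    IsFreeGroup (Γ.restrictInclusion hg Set.univ).artinMap.ker :=
  isFreeGroup_ker_of_injective
    (Inclusion.artinMap_injective _ fun _ _ hxy => ⟨hxy, Set.mem_univ _⟩)

end LabelledGraph

theorem mainTheorem10 :
    (∀ (V : Type u) [Finite V] (Γ₁ Γ₂ : LabelledGraph V) (a b : V)
      (h : LabelledGraph.AddsEdge Γ₁ Γ₂ a b),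
      IsFreeGroup h.inclusion.artinMap.ker) ∧
    (∀ (V : Type u) (W : Type v) [Finite V] [Finite W]
      (Γ₁ : LabelledGraph V) (Γ₂ : LabelledGraph W) (_ : LabelledGraph.Inclusion Γ₁ Γ₂),
      (IsPolyFree Γ₂.ArtinGroup → IsPolyFree Γ₁.ArtinGroup) ∧
      (IsNormallyPolyFree Γ₂.ArtinGroup → IsNormallyPolyFree Γ₁.ArtinGroup) ∧
      (IsVirtuallyPolyFree Γ₂.ArtinGroup → IsVirtuallyPolyFree Γ₁.ArtinGroup) ∧
      (IsVirtuallyNormallyPolyFree Γ₂.ArtinGroup → IsVirtuallyNormallyPolyFree Γ₁.ArtinGroup)) := by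
  refine ⟨fun V _ Γ₁ Γ₂ a b h => h.isFreeGroup_ker, fun V W _ _ Γ₁ Γ₂ i => ?_⟩
  -- The full subgraph on the image of `V` is reached first: this step crosses from universe `v` to
  -- `u`, while edges are removed with a property `P` of groups in `u` alone.
  have hker := Γ₂.isFreeGroup_ker_restrictInclusion i.injective
  refine ⟨fun h => ?_, fun h => ?_, fun h => ?_, fun h => ?_⟩
  · exact i.artinGroup_of_restrict (P := fun G _ => IsPolyFree G)
      (fun _ _ _ _ f _ h => h.of_hom f) (h.of_hom (Γ₂.restrictInclusion i.injective _).artinMap)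
  · exact i.artinGroup_of_restrict (P := fun G _ => IsNormallyPolyFree G)
      (fun _ _ _ _ f _ h => h.of_hom f) (h.of_hom (Γ₂.restrictInclusion i.injective _).artinMap)
  · exact i.artinGroup_of_restrict (P := fun G _ => IsVirtuallyPolyFree G)
      (fun _ _ _ _ f _ h => h.of_hom f) (h.of_hom (Γ₂.restrictInclusion i.injective _).artinMap)
  · exact i.artinGroup_of_restrict (P := fun G _ => IsVirtuallyNormallyPolyFree G)
      (fun _ _ _ _ f _ h => h.of_hom f) (h.of_hom (Γ₂.restrictInclusion i.injective _).artinMap)
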